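/- Let $H$ be a separable complex Hilbert space, let $a>0$ and $\delta\in(0,1)$, and let $(A,B)$ be linear operators in $H$ such that $A$ is skew-adjoint with domain $D(A)$, $\mathrm{i}A$ is bounded from below, $B$ is skew-symmetric, $D(A)\subseteq D(B)$, and $\|B\psi\|\le a\|A\psi\|$ for every $\psi\in D(A)$. Let $\mathcal U_{\delta,a}$ be the set of functions $u:\mathbf R\to\left(-\frac{1-\delta}{a},\frac{1-\delta}{a}\right)$ of bounded variation with $u(t)=0$ for $t\le 0$. For $\lambda\in\mathbf R$ put $A_\lambda=A+\mathrm{i}\lambda\,\mathrm{Id}$ with domain $D(A)$. For $M\in\{A,A_\lambda\}$ and a piecewise constant $v\in\mathcal U_{\delta,a}$, the propagator of $x'=(M+v(t)B)x$ from time $0$ to time $t\ge 0$ is the concatenation $e^{t_p(M+v_pB)}\cdots e^{t_1(M+v_1B)}$ of unitary groups, where $v$ takes on $[0,t]$ successively the values $v_1,\dots,v_p$ for times $t_1,\dots,t_p$. For an arbitrary $u\in\mathcal U_{\delta,a}$, the propagator from $0$ to $t$ is the bounded operator on $H$ that extends $\psi\mapsto\lim_n\Upsilon_n\psi$, $\psi\in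 D(A)$, where $\Upsilon_n$ is the propagator from $0$ to $t$ for $u_n$, and $(u_n)_n$ is any sequence of piecewise constant functions in $\mathcal U_{\delta,a}$ that tends to $u$ pointwise and satisfies $TV_{[0,T]}(u_n)\le TV_{[0,T]}(u)$ for all $n$, for some $T\ge t$ (the limit exists and does not depend on $T$ or on the sequence). Then for every $u\in\mathcal U_{\delta,a}$, every $\lambda\in\mathbf R$ and every $t\ge 0$, the propagators $\Upsilon^{u}_{t,0}$ of $x'=(A+uB)x$ and $\Upsilon^{u,\lambda}_{t,0}$ of $x'=(A_\lambda+uB)x$ are well defined (they exist and are unique), and $$\Upsilon^{u,\lambda}_{t,0}=e^{\mathrm{i}\lambda t}\,\Upsilon^{u}_{t,0}.$$ -/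

import Mathlib

open Set Filter Topology

namespace BVControl

section Operators

variable {H : Type*} [NormedAddCommGroup H] [InnerProductSpace ℂ H] [CompleteSpace H]

/-- A (possibly unbounded) operator is skew-adjoint when it is densely defined and its Hilbert space
adjoint, domain included, is its opposite. -/
def IsSkewAdjoint (A : H →ₗ.[ℂ] H) : Prop :=
  Dense (A.domain : Set H) ∧ A.adjoint = -A

/-- A (possibly unbounded) operator `B` is skew-symmetric when `⟪Bx, y⟫ = -⟪x, By⟫` on its domain. -/
def IsSkewSymmetric (B : H →ₗ.[ℂ] H) : Prop :=
  ∀ x y : B.domain, inner ℂ (B x) (y : H) = -inner ℂ (x : H) (B y)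

/-- The assumptions on the pair `(A, B)`: `A` is skew-adjoint, `iA` is bounded from below,
`B` is skew-symmetric, `D(A) ⊆ D(B)` and `‖Bψ‖ ≤ a ‖Aψ‖ + b ‖ψ‖` for every `ψ ∈ D(A)`. -/
structure Hypothesis1 (A B : H →ₗ.[ℂ] H) (a b : ℝ) : Prop where
  a_nonneg : 0 ≤ a
  b_nonneg : 0 ≤ b
  skewAdjoint : IsSkewAdjoint A
  boundedBelow : ∃ m : ℝ, ∀ x : A.domain,
    m * ‖(x : H)‖ ^ 2 ≤ (inner ℂ (x : H) (Complex.I • A x)).re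
  skewSymmetric : IsSkewSymmetric B
  domain_le : A.domain ≤ B.domain
  relBound : ∀ x : A.domain,
    ‖B (Submodule.inclusion domain_le x)‖ ≤ a * ‖A x‖ + b * ‖(x : H)‖

/-- The operator `A + iλ Id`, with domain `D(A)`. -/
noncomputable def shift (A : H →ₗ.[ℂ] H) (lam : ℝ) : H →ₗ.[ℂ] H :=
  ((Complex.I * (lam : ℂ)) • (LinearMap.id : H →ₗ[ℂ] H)) +ᵥ A

/-- `G` is the strongly continuous unitary group `s ↦ e^{sL}`: its infinitesimal generator,
domain included, is exactly the operator `L`. -/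
structure IsUnitaryGroupOf (L : H →ₗ.[ℂ] H) (G : ℝ → H →L[ℂ] H) : Prop where
  map_zero : G 0 = 1
  map_add : ∀ s t : ℝ, G (s + t) = G s * G t
  norm_map : ∀ (s : ℝ) (x : H), ‖G s x‖ = ‖x‖
  strongly_continuous : ∀ x : H, Continuous fun s : ℝ => G s x
  generator : ∀ x y : H, (x, y) ∈ L.graph ↔ HasDerivAt (fun s : ℝ => G s x) y 0

end Operators

section Controls

/-- The set `𝒰` of functions `u : ℝ → ℝ` of bounded variation with `u = 0` on `(-∞, 0]`. -/
def controls : Set (ℝ → ℝ) :=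
  {u | BoundedVariationOn u univ ∧ ∀ t ≤ 0, u t = 0}

/-- The set `𝒰_{δ,a}` of the `u ∈ 𝒰` with values in `(-(1-δ)/a, (1-δ)/a)`. -/
def boundedControls (δ a : ℝ) : Set (ℝ → ℝ) :=
  {u | u ∈ controls ∧ ∀ t, u t ∈ Ioo (-(1 - δ) / a) ((1 - δ) / a)}

/-- On `[0, T]`, the function `v` takes the constant value `c k` on the open interval between
consecutive points `τ k < τ (k + 1)`, `k < N`, of the subdivision `0 = τ 0 < ⋯ < τ N = T`. -/
def IsStepOn (v : ℝ → ℝ) (T : ℝ) (N : ℕ) (τ c : ℕ → ℝ) : Prop :=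
  τ 0 = 0 ∧ τ N = T ∧
    ∀ k < N, τ k < τ (k + 1) ∧ ∀ s ∈ Ioo (τ k) (τ (k + 1)), v s = c k

/-- `v` is piecewise constant: on every `[0, T]` it takes finitely many values, each on an interval
(up to the values at the switching times). -/
def IsPiecewiseConstant (v : ℝ → ℝ) : Prop :=
  ∀ T : ℝ, 0 ≤ T → ∃ (N : ℕ) (τ c : ℕ → ℝ), IsStepOn v T N τ c

/-- `(v n)` is a sequence of piecewise constant controls in `𝒰_{δ,a}` that tends to `u` pointwise and
whose total variations on `[0, T]` are at most that of `u`. -/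
structure IsApproximation (δ a T : ℝ) (u : ℝ → ℝ) (v : ℕ → ℝ → ℝ) : Prop where
  mem : ∀ n, v n ∈ boundedControls δ a
  piecewiseConstant : ∀ n, IsPiecewiseConstant (v n)
  tendsto : ∀ s : ℝ, Tendsto (fun n => v n s) atTop (𝓝 (u s))
  variation_le : ∀ n, eVariationOn (v n) (Icc 0 T) ≤ eVariationOn u (Icc 0 T)

end Controls

section Propagators

variable {H : Type*} [NormedAddCommGroup H] [InnerProductSpace ℂ H] [CompleteSpace H]

/-- The concatenation `G (N-1) (τ N - τ (N-1)) ∘ ⋯ ∘ G 0 (τ 1 - τ 0)`. -/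
def concatenation (G : ℕ → ℝ → H →L[ℂ] H) (τ : ℕ → ℝ) : ℕ → H →L[ℂ] H
  | 0 => 1
  | k + 1 => G k (τ (k + 1) - τ k) * concatenation G τ k

/-- `W` is the propagator from time `0` to time `t` of `x' = (A + v B) x` for the piecewise constant
control `v`, that is `W = e^{(τ N - τ (N-1)) (A + c (N-1) B)} ∘ ⋯ ∘ e^{(τ 1 - τ 0) (A + c 0 B)}`,
where `c k` is the value of `v` between `τ k` and `τ (k + 1)`. -/
def IsStepPropagator (A B : H →ₗ.[ℂ] H) (v : ℝ → ℝ) (t : ℝ) (W : H →L[ℂ] H) : Prop :=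
  ∃ (N : ℕ) (τ c : ℕ → ℝ) (G : ℕ → ℝ → H →L[ℂ] H),
    IsStepOn v t N τ c ∧
    (∀ k < N, IsUnitaryGroupOf (A + (c k : ℂ) • B) (G k)) ∧
    W = concatenation G τ N

/-- `U` is the propagator `Υ^u_{t,0}` of `x' = (A + u B) x` for the control `u ∈ 𝒰_{δ,a}`: the
bounded operator on `H` that extends `ψ ↦ lim Υ^{v n}_{t,0} ψ`, `ψ ∈ D(A)`, where `(v n)` is a
sequence of piecewise constant controls tending to `u`. It is part of the definition that, for every
time horizon `T ≥ t`, such sequences exist, that their propagators `Υ^{v n}_{t,0}` exist, and that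
the limit exists and is the same for all of them. -/
def IsPropagator (A B : H →ₗ.[ℂ] H) (δ a : ℝ) (u : ℝ → ℝ) (t : ℝ) (U : H →L[ℂ] H) : Prop :=
  ∀ T : ℝ, t ≤ T →
    (∃ v : ℕ → ℝ → ℝ, IsApproximation δ a T u v) ∧
    ∀ v : ℕ → ℝ → ℝ, IsApproximation δ a T u v →
      (∃ W : ℕ → H →L[ℂ] H, ∀ n, IsStepPropagator A B (v n) t (W n)) ∧
      ∀ W : ℕ → H →L[ℂ] H, (∀ n, IsStepPropagator A B (v n) t (W n)) →
        ∀ ψ ∈ A.domain, Tendsto (fun n => W n ψ) atTop (𝓝 (U ψ))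

end Propagators

end BVControl

/-! Multiplying the group of `A + cB` by the phase `e^{iλs}` gives the group of `A + iλ + cB`. The
phases multiply over a concatenation, so step propagators for `A` and `A_λ` correspond through the
factor `e^{iλt}`. The admissible approximating sequences do not involve the operators, so the
correspondence survives the limit (`IsPropagator.shift_iff`). It also carries existence and
uniqueness from `A` to `A_λ`; the bound `‖Bψ‖ ≤ a‖A_λψ‖` may fail, so the existence theorem is
applied to `A` alone.

Existence for `A` rests on three facts. Each `A + cB` with `|c|a < 1` generates a unitary group, by
a Neumann series (`isMaximalSkew_perturb`) and Stone's theorem (`exists_isUnitaryGroupOf`). Along a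
step propagator the quantity `‖(A + cB)x‖` is conserved on each piece and grows by at most
`exp((a/δ)|Δc|)` at a switch, so `‖Ax‖` is bounded in terms of the variation only
(`exists_concatenation`). Finally the energy estimate `norm_sub_sq_le` controls the distance of two
trajectories by the `L¹` distance of their controls, which tends to zero by dominated convergence.
Step propagators are isometries, so convergence on the dense domain extends to `H`. -/

namespace BVControl

/-! ### Resolvents of skew-symmetric operators and bounded approximations -/

section Stone

variable {H : Type*} [NormedAddCommGroup H] [InnerProductSpace ℂ H]

/-- Densely defined skew-symmetric operators `L` for which every `1 - εL`, `ε ≠ 0` real, is onto. -/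
structure IsMaximalSkew (L : H →ₗ.[ℂ] H) : Prop where
  dense : Dense (L.domain : Set H)
  skew : IsSkewSymmetric L
  surj : ∀ (ε : ℝˣ) (y : H), ∃ x : L.domain, (x : H) - ((ε : ℝ) : ℂ) • L x = y

theorem IsSkewSymmetric.re_inner_self {L : H →ₗ.[ℂ] H} (hL : IsSkewSymmetric L) (x : L.domain) :
    (inner ℂ (x : H) (L x)).re = 0 := by
  have h := congrArg Complex.re (hL x x)
  have h2 : (inner ℂ (L x) (x : H)).re = (inner ℂ (x : H) (L x)).re := inner_re_symm (𝕜 := ℂ) _ _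
  rw [Complex.neg_re] at h
  linarith

theorem IsSkewSymmetric.norm_le_norm_sub {L : H →ₗ.[ℂ] H} (hL : IsSkewSymmetric L) (ε : ℝˣ)
    (x : L.domain) : ‖(x : H)‖ ≤ ‖(x : H) - ((ε : ℝ) : ℂ) • L x‖ := by
  have h1 : (inner ℂ (x : H) ((x : H) - ((ε : ℝ) : ℂ) • L x)).re = ‖(x : H)‖ ^ 2 := by
    rw [inner_sub_right, inner_smul_right, Complex.sub_re, Complex.re_ofReal_mul,
      hL.re_inner_self, mul_zero, sub_zero]
    exact inner_self_eq_norm_sq (𝕜 := ℂ) _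
  have h2 : (inner ℂ (x : H) ((x : H) - ((ε : ℝ) : ℂ) • L x)).re ≤
      ‖(x : H)‖ * ‖(x : H) - ((ε : ℝ) : ℂ) • L x‖ := re_inner_le_norm (𝕜 := ℂ) _ _
  rcases (norm_nonneg (x : H)).eq_or_lt with h | h
  · rw [← h]; exact norm_nonneg _
  · refine le_of_mul_le_mul_left ?_ h
    rw [← pow_two, ← h1]; exact h2

/-- The operator `1 - εL`. -/
noncomputable def oneSub (L : H →ₗ.[ℂ] H) (ε : ℝˣ) : L.domain →ₗ[ℂ] H :=
  L.domain.subtype - ((ε : ℝ) : ℂ) • L.toFun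

theorem oneSub_apply (L : H →ₗ.[ℂ] H) (ε : ℝˣ) (x : L.domain) :
    oneSub L ε x = (x : H) - ((ε : ℝ) : ℂ) • L x := rfl

theorem IsMaximalSkew.bijective {L : H →ₗ.[ℂ] H} (hL : IsMaximalSkew L) (ε : ℝˣ) :
    Function.Bijective (oneSub L ε) := by
  refine ⟨?_, fun y => hL.surj ε y⟩
  rw [injective_iff_map_eq_zero]
  intro x hx
  have := hL.skew.norm_le_norm_sub ε x
  rw [← oneSub_apply, hx, norm_zero] at this
  exact Subtype.ext (norm_le_zero_iff.1 this)

/-- The resolvent `(1 - εL)⁻¹`. -/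
noncomputable def IsMaximalSkew.resolvent {L : H →ₗ.[ℂ] H} (hL : IsMaximalSkew L) (ε : ℝˣ) :
    H →L[ℂ] H :=
  (L.domain.subtype ∘ₗ (LinearEquiv.ofBijective (oneSub L ε) (hL.bijective ε)).symm.toLinearMap
    ).mkContinuous 1 fun y => by
      have h := hL.skew.norm_le_norm_sub ε
        ((LinearEquiv.ofBijective (oneSub L ε) (hL.bijective ε)).symm y)
      rw [← oneSub_apply, LinearEquiv.apply_ofBijective_symm_apply] at h
      simpa using h

namespace IsMaximalSkew

variable {L : H →ₗ.[ℂ] H} (hL : IsMaximalSkew L)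
include hL

theorem exists_resolvent_eq (ε : ℝˣ) (y : H) :
    ∃ x : L.domain, hL.resolvent ε y = x ∧ (x : H) - ((ε : ℝ) : ℂ) • L x = y :=
  ⟨(LinearEquiv.ofBijective (oneSub L ε) (hL.bijective ε)).symm y, rfl, by
    rw [← oneSub_apply, LinearEquiv.apply_ofBijective_symm_apply]⟩

theorem resolvent_sub (ε : ℝˣ) (x : L.domain) :
    hL.resolvent ε ((x : H) - ((ε : ℝ) : ℂ) • L x) = x := by
  rw [← oneSub_apply]
  exact congrArg Subtype.val
    (LinearEquiv.ofBijective_symm_apply_apply (oneSub L ε) (h := hL.bijective ε) x)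

theorem norm_resolvent_le (ε : ℝˣ) (y : H) : ‖hL.resolvent ε y‖ ≤ ‖y‖ := by
  obtain ⟨x, h1, h2⟩ := hL.exists_resolvent_eq ε y
  rw [h1, ← h2]
  exact hL.skew.norm_le_norm_sub ε x

theorem resolvent_apply_sub_self (ε : ℝˣ) (x : L.domain) :
    hL.resolvent ε x - x = ((ε : ℝ) : ℂ) • hL.resolvent ε (L x) := by
  have := hL.resolvent_sub ε x
  rw [map_sub, map_smul] at this
  rw [sub_eq_iff_eq_add, ← sub_eq_iff_eq_add', this]

theorem exists_resolvent_apply (ε : ℝˣ) (x : L.domain) :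
    ∃ z : L.domain, hL.resolvent ε x = z ∧ L z = hL.resolvent ε (L x) := by
  obtain ⟨w, h1, h2⟩ := hL.exists_resolvent_eq ε (L x)
  -- The witness comes from `R x = x + εR(Lx)`, where `R` is the resolvent at `ε` and `w = R(Lx)`.
  refine ⟨x + ((ε : ℝ) : ℂ) • w, ?_, ?_⟩
  · rw [sub_eq_iff_eq_add'.1 (hL.resolvent_apply_sub_self ε x), h1]; simp
  · rw [L.map_add, L.map_smul, h1, ← h2]; simp

/-- Each resolvent preserves the domain and commutes with `L` there, hence with `1 - ηL`, hence with
the inverse of the latter. -/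
theorem resolvent_commute (ε η : ℝˣ) : Commute (hL.resolvent ε) (hL.resolvent η) := by
  ext y
  obtain ⟨z, h1, h2⟩ := hL.exists_resolvent_eq η y
  obtain ⟨w, h3, h4⟩ := hL.exists_resolvent_apply ε z
  have h5 := hL.resolvent_sub η w
  rw [h4, ← h3, ← map_smul, ← map_sub, h2] at h5
  simp only [mul_apply_eq_comp, h1, h5]

/-- By skew-symmetry the resolvents at `ε` and `-ε` are adjoint to each other. This makes their
difference, and so `approx`, skew. -/
theorem inner_resolvent (ε : ℝˣ) (y : H) :
    (inner ℂ (hL.resolvent ε y) y).re = (inner ℂ (hL.resolvent (-ε) y) y).re := by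
  obtain ⟨p, h1, h2⟩ := hL.exists_resolvent_eq ε y
  obtain ⟨q, h3, h4⟩ := hL.exists_resolvent_eq (-ε) y
  have h : inner ℂ (p : H) y = inner ℂ y (q : H) := by
    nth_rewrite 1 [← h4]
    nth_rewrite 1 [← h2]
    rw [inner_sub_right, inner_sub_left, inner_smul_left, inner_smul_right, hL.skew p q]
    simp
  rw [h1, h3, h]
  exact inner_re_symm (𝕜 := ℂ) _ _

/-- The bounded skew-adjoint approximation `L (1 - ε²L²)⁻¹` of `L`. -/
noncomputable def approx (ε : ℝˣ) : H →L[ℂ] H :=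
  ((2 * (ε : ℝ))⁻¹ : ℝ) • (hL.resolvent ε - hL.resolvent (-ε))

theorem re_inner_approx (ε : ℝˣ) (y : H) : (inner ℂ (hL.approx ε y) y).re = 0 := by
  have : hL.approx ε y = (((2 * (ε : ℝ))⁻¹ : ℝ) : ℂ) • (hL.resolvent ε y - hL.resolvent (-ε) y) := rfl
  rw [this, inner_smul_left, inner_sub_left, Complex.conj_ofReal, Complex.re_ofReal_mul,
    Complex.sub_re, hL.inner_resolvent, sub_self, mul_zero]

theorem approx_commute (ε η : ℝˣ) : Commute (hL.approx ε) (hL.approx η) := by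
  refine Commute.smul_left (Commute.smul_right ?_ _) _
  exact ((hL.resolvent_commute _ _).sub_left (hL.resolvent_commute _ _)).sub_right
    ((hL.resolvent_commute _ _).sub_left (hL.resolvent_commute _ _))

/-- The division by `ε` disappears on the domain; since resolvents tend strongly to the identity,
`approx` tends to `L` there. -/
theorem approx_apply (ε : ℝˣ) (x : L.domain) :
    hL.approx ε x = (2⁻¹ : ℝ) • (hL.resolvent ε (L x) + hL.resolvent (-ε) (L x)) := by
  have h1 := hL.resolvent_apply_sub_self ε x
  have h2 := hL.resolvent_apply_sub_self (-ε) x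
  have h3 : hL.resolvent ε x - hL.resolvent (-ε) x =
      (ε : ℝ) • (hL.resolvent ε (L x) + hL.resolvent (-ε) (L x)) := by
    have : hL.resolvent ε x - hL.resolvent (-ε) x = (hL.resolvent ε x - x) -
      (hL.resolvent (-ε) x - x) := by abel
    rw [this, h1, h2, ← Complex.coe_smul (ε : ℝ) (_ : H)]
    rw [Units.val_neg]
    push_cast
    module
  change ((2 * (ε : ℝ))⁻¹ : ℝ) • (hL.resolvent ε x - hL.resolvent (-ε) x) = _
  rw [h3, smul_smul]
  congr 1
  have := ε.ne_zero
  field_simp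

end IsMaximalSkew

theorem cauchySeq_of_cauchySeq_dense {E : Type*} [NormedAddCommGroup E] [NormedSpace ℂ E]
    {W : ℕ → E →L[ℂ] H} (hW : ∀ n x, ‖W n x‖ ≤ ‖x‖) {D : Set E} (hD : Dense D)
    (h : ∀ x ∈ D, CauchySeq fun n => W n x) (x : E) : CauchySeq fun n => W n x := by
  rw [Metric.cauchySeq_iff']
  intro ε hε
  obtain ⟨y, hy, hxy⟩ := Metric.dense_iff.1 hD x (ε / 3) (by positivity)
  rw [Metric.mem_ball, dist_eq_norm] at hy
  obtain ⟨N, hN⟩ := Metric.cauchySeq_iff'.1 (h y hxy) (ε / 3) (by positivity)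
  refine ⟨N, fun n hn => ?_⟩
  have := hN n hn
  rw [dist_eq_norm] at this ⊢
  have e : W n x - W N x = (W n y - W N y) - W n (y - x) + W N (y - x) := by
    rw [map_sub, map_sub]; abel
  calc ‖W n x - W N x‖ ≤ ‖W n y - W N y‖ + ‖y - x‖ + ‖y - x‖ := by
        rw [e]
        refine (norm_add_le _ _).trans (add_le_add ((norm_sub_le _ _).trans ?_) (hW _ _))
        exact add_le_add_right (hW _ _) _
    _ < ε := by linarith

/-- A sequence of contractions that is pointwise Cauchy on a dense set converges strongly. -/
theorem exists_tendsto_of_cauchySeq_dense {E : Type*} [NormedAddCommGroup E] [NormedSpace ℂ E]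
    [CompleteSpace E] [CompleteSpace H]
    {W : ℕ → E →L[ℂ] H} (hW : ∀ n x, ‖W n x‖ ≤ ‖x‖) {D : Set E} (hD : Dense D)
    (h : ∀ x ∈ D, CauchySeq fun n => W n x) :
    ∃ V : E →L[ℂ] H, ∀ x, Tendsto (fun n => W n x) atTop (𝓝 (V x)) := by
  choose f hf using fun x => cauchySeq_tendsto_of_complete (cauchySeq_of_cauchySeq_dense hW hD h x)
  exact ⟨continuousLinearMapOfTendsto W (tendsto_pi_nhds.2 hf), hf⟩

end Stone


/-! ### Exponentials of bounded skew operators -/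

section BoundedGroups

variable {H : Type*} [NormedAddCommGroup H] [InnerProductSpace ℂ H] [CompleteSpace H]

theorem hasDerivAt_exp_smul_apply (S : H →L[ℂ] H) (x : H) (t : ℝ) :
    HasDerivAt (fun s : ℝ => NormedSpace.exp (s • S) x) (NormedSpace.exp (t • S) (S x)) t :=
  ((ContinuousLinearMap.apply ℂ H x).restrictScalars ℝ).hasFDerivAt.comp_hasDerivAt t
    (hasDerivAt_exp_smul_const S t)

theorem hasDerivAt_exp_smul_apply' (S : H →L[ℂ] H) (x : H) (t : ℝ) :
    HasDerivAt (fun s : ℝ => NormedSpace.exp (s • S) x) (S (NormedSpace.exp (t • S) x)) t :=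
  ((ContinuousLinearMap.apply ℂ H x).restrictScalars ℝ).hasFDerivAt.comp_hasDerivAt t
    (hasDerivAt_exp_smul_const' S t)

omit [CompleteSpace H] in
theorem _root_.HasDerivWithinAt.normSq {x : ℝ → H} {y : H} {s : Set ℝ} {t : ℝ}
    (hx : HasDerivWithinAt x y s t) :
    HasDerivWithinAt (fun r => ‖x r‖ ^ 2) (2 * (inner ℂ (x t) y).re) s t := by
  let _ : InnerProductSpace ℝ H := InnerProductSpace.rclikeToReal ℂ H
  exact hx.norm_sq

variable {S : H →L[ℂ] H} (hS : ∀ y, (inner ℂ (S y) y).re = 0)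
include hS

theorem norm_exp_smul_apply (t : ℝ) (x : H) : ‖NormedSpace.exp (t • S) x‖ = ‖x‖ := by
  have hd : ∀ s : ℝ, HasDerivAt (fun s : ℝ => ‖NormedSpace.exp (s • S) x‖ ^ 2) 0 s := fun s => by
    rw [← hasDerivWithinAt_univ]
    refine (hasDerivAt_exp_smul_apply' S x s).hasDerivWithinAt.normSq.congr_deriv ?_
    have := hS (NormedSpace.exp (s • S) x)
    have h2 := inner_re_symm (𝕜 := ℂ) (NormedSpace.exp (s • S) x) (S (NormedSpace.exp (s • S) x))
    simp only [RCLike.re_to_complex] at h2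
    rw [h2, this, mul_zero]
  have := is_const_of_deriv_eq_zero (fun s => (hd s).differentiableAt) (fun s => (hd s).deriv) t 0
  simp only [zero_smul, NormedSpace.exp_zero, one_apply_eq_self] at this
  exact (pow_left_inj₀ (norm_nonneg _) (norm_nonneg _) two_ne_zero).1 this

-- Mean value inequality for `s ↦ exp(sS)x - sy`. With `y = 0` it gives a Lipschitz bound; with `y =
-- Lx` it gives a derivative estimate that can pass to the limit in `S`.
omit hS in
theorem norm_exp_smul_apply_sub_sub_le (t : ℝ) (x y : H) {C : ℝ}
    (hC : ∀ s : ℝ, |s| ≤ |t| → ‖NormedSpace.exp (s • S) (S x) - y‖ ≤ C) :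
    ‖NormedSpace.exp (t • S) x - x - t • y‖ ≤ C * |t| := by
  have hd : ∀ s ∈ Metric.closedBall (0 : ℝ) |t|, HasDerivWithinAt
      (fun s : ℝ => NormedSpace.exp (s • S) x - s • y)
      (NormedSpace.exp (s • S) (S x) - y) (Metric.closedBall (0 : ℝ) |t|) s := fun s _ =>
    ((hasDerivAt_exp_smul_apply S x s).sub
      (by simpa using (hasDerivAt_id s).smul_const y)).hasDerivWithinAt
  have := (convex_closedBall (0 : ℝ) |t|).norm_image_sub_le_of_norm_hasDerivWithin_le
    (C := C) hd (fun s hs => hC s (by simpa using hs)) (x := 0) (y := t) (by simp) (by simp)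
  simpa [sub_right_comm] using this

theorem norm_exp_smul_apply_sub_le (t : ℝ) (x : H) :
    ‖NormedSpace.exp (t • S) x - x‖ ≤ |t| * ‖S x‖ := by
  have := norm_exp_smul_apply_sub_sub_le t x 0 (C := ‖S x‖)
    (fun s _ => by rw [sub_zero, norm_exp_smul_apply hS])
  simpa [mul_comm] using this

end BoundedGroups

/-! ### Stone's theorem -/

section Stone

variable {H : Type*} [NormedAddCommGroup H] [InnerProductSpace ℂ H] [CompleteSpace H]

theorem exp_add_smul_apply (S : H →L[ℂ] H) (s t : ℝ) :
    NormedSpace.exp ((s + t) • S) = NormedSpace.exp (s • S) * NormedSpace.exp (t • S) := by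
  let _ : NormedAlgebra ℚ (H →L[ℂ] H) := NormedAlgebra.restrictScalars ℚ ℂ _
  rw [add_smul, NormedSpace.exp_add_of_commute]
  exact ((Commute.refl S).smul_left s).smul_right t

/-- Commutation allows the factorization `exp(tS) = exp(tT) exp(t(S - T))`, whose first factor is an
isometry. -/
theorem norm_exp_sub_exp_le {S T : H →L[ℂ] H} (hST : Commute S T)
    (hS : ∀ y, (inner ℂ (S y) y).re = 0) (hT : ∀ y, (inner ℂ (T y) y).re = 0) (t : ℝ) (x : H) :
    ‖NormedSpace.exp (t • S) x - NormedSpace.exp (t • T) x‖ ≤ |t| * ‖S x - T x‖ := by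
  let _ : NormedAlgebra ℚ (H →L[ℂ] H) := NormedAlgebra.restrictScalars ℚ ℂ _
  have h : NormedSpace.exp (t • S) = NormedSpace.exp (t • T) * NormedSpace.exp (t • (S - T)) := by
    rw [← NormedSpace.exp_add_of_commute, ← smul_add, add_sub_cancel]
    exact ((hST.symm.sub_right (Commute.refl T)).smul_left t).smul_right t
  have hD : ∀ y, (inner ℂ ((S - T) y) y).re = 0 := fun y => by
    rw [sub_apply, inner_sub_left, Complex.sub_re, hS, hT, sub_zero]
  rw [h, mul_apply_eq_comp, ← map_sub, norm_exp_smul_apply hT]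
  exact norm_exp_smul_apply_sub_le hD t x

/-- The sequence `1 / (n + 1)`, as units. -/
noncomputable def oneDivSucc (n : ℕ) : ℝˣ :=
  Units.mk0 (1 / ((n : ℝ) + 1)) (by positivity)

namespace IsMaximalSkew

variable {L : H →ₗ.[ℂ] H} (hL : IsMaximalSkew L)
include hL

omit [CompleteSpace H] in
theorem tendsto_resolvent {ε : ℕ → ℝˣ} (hε : Tendsto (fun n => (ε n : ℝ)) atTop (𝓝 0)) (x : H) :
    Tendsto (fun n => hL.resolvent (ε n) x) atTop (𝓝 x) := by
  rw [Metric.tendsto_nhds]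
  intro r hr
  obtain ⟨y, hy, hxy⟩ := Metric.dense_iff.1 hL.dense x (r / 3) (by positivity)
  rw [Metric.mem_ball, dist_eq_norm] at hy
  have h0 : Tendsto (fun n => |(ε n : ℝ)| * ‖L ⟨y, hxy⟩‖) atTop (𝓝 0) := by
    simpa using hε.abs.mul_const ‖L ⟨y, hxy⟩‖
  filter_upwards [h0.eventually_lt_const (show 0 < r / 3 by positivity)] with n hn
  rw [dist_eq_norm]
  have h1 := hL.resolvent_apply_sub_self (ε n) ⟨y, hxy⟩
  have h2 : ‖hL.resolvent (ε n) y - y‖ < r / 3 := by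
    refine lt_of_le_of_lt ?_ hn
    rw [h1, norm_smul, Complex.norm_real, Real.norm_eq_abs]
    exact mul_le_mul_of_nonneg_left (hL.norm_resolvent_le _ _) (abs_nonneg _)
  have e : hL.resolvent (ε n) x - x =
      (hL.resolvent (ε n) y - y) - hL.resolvent (ε n) (y - x) + (y - x) := by
    rw [map_sub]; abel
  calc ‖hL.resolvent (ε n) x - x‖
      ≤ ‖hL.resolvent (ε n) y - y‖ + ‖y - x‖ + ‖y - x‖ := by
        rw [e]
        refine (norm_add_le _ _).trans (add_le_add ((norm_sub_le _ _).trans ?_) le_rfl)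
        exact add_le_add_right (hL.norm_resolvent_le _ _) _
    _ < r := by linarith

omit [CompleteSpace H] in
theorem tendsto_approx (x : L.domain) :
    Tendsto (fun n : ℕ => hL.approx (oneDivSucc n) x) atTop (𝓝 (L x)) := by
  have h0 : Tendsto (fun n => (oneDivSucc n : ℝ)) atTop (𝓝 0) :=
    tendsto_one_div_add_atTop_nhds_zero_nat (𝕜 := ℝ)
  have h := ((hL.tendsto_resolvent h0 (L x)).add
    (hL.tendsto_resolvent (ε := fun n => -oneDivSucc n)
      (by simpa [oneDivSucc] using h0.neg) (L x))).const_smul (2⁻¹ : ℝ)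
  have e : (2⁻¹ : ℝ) • (L x + L x) = L x := by rw [← two_smul ℝ, smul_smul]; simp
  rw [e] at h
  exact h.congr fun n => (hL.approx_apply _ x).symm

theorem exists_tendsto_exp (t : ℝ) : ∃ V : H →L[ℂ] H, ∀ x,
    Tendsto (fun n : ℕ => NormedSpace.exp (t • hL.approx (oneDivSucc n)) x) atTop
      (𝓝 (V x)) := by
  refine exists_tendsto_of_cauchySeq_dense
    (fun n x => (norm_exp_smul_apply (hL.re_inner_approx _) t x).le) hL.dense fun x hx => ?_
  have h := (hL.tendsto_approx ⟨x, hx⟩).cauchySeq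
  rw [Metric.cauchySeq_iff] at h ⊢
  intro r hr
  obtain ⟨N, hN⟩ := h (r / (|t| + 1)) (by positivity)
  refine ⟨N, fun m hm n hn => ?_⟩
  have h1 := hN m hm n hn
  rw [dist_eq_norm] at h1 ⊢
  rw [lt_div_iff₀ (by positivity)] at h1
  refine (norm_exp_sub_exp_le (hL.approx_commute _ _) (hL.re_inner_approx _)
    (hL.re_inner_approx _) t x).trans_lt (lt_of_le_of_lt ?_ h1)
  nlinarith [norm_nonneg (hL.approx (oneDivSucc m) x - hL.approx (oneDivSucc n) x)]

/-- A densely defined skew-symmetric operator with full resolvent ranges generates a strongly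
continuous unitary group. -/
theorem exists_isUnitaryGroupOf : ∃ G : ℝ → H →L[ℂ] H, IsUnitaryGroupOf L G := by
  choose G hG using hL.exists_tendsto_exp
  have hskew := fun n : ℕ => hL.re_inner_approx (oneDivSucc n)
  have norm_map : ∀ (s : ℝ) (x : H), ‖G s x‖ = ‖x‖ := fun s x => by
    refine tendsto_nhds_unique (hG s x).norm ?_
    simp only [norm_exp_smul_apply (hskew _)]
    exact tendsto_const_nhds
  have map_zero : G 0 = 1 := by
    ext x
    refine tendsto_nhds_unique (hG 0 x) ?_
    simp
  have map_add : ∀ s t : ℝ, G (s + t) = G s * G t := fun s t => by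
    ext x
    refine tendsto_nhds_unique (hG (s + t) x) ?_
    rw [mul_apply_eq_comp, tendsto_iff_norm_sub_tendsto_zero]
    have h1 := tendsto_iff_norm_sub_tendsto_zero.1 (hG s (G t x))
    have h2 := tendsto_iff_norm_sub_tendsto_zero.1 (hG t x)
    have h3 := h2.add h1
    rw [add_zero] at h3
    refine squeeze_zero (fun _ => norm_nonneg _) (fun n => ?_) h3
    rw [exp_add_smul_apply, mul_apply_eq_comp, ← norm_exp_smul_apply (hskew n) s
      (NormedSpace.exp (t • hL.approx (oneDivSucc n)) x - G t x), map_sub]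
    exact norm_sub_le_norm_sub_add_norm_sub _ _ _
  have sub_le : ∀ (s : ℝ) (x : L.domain), ‖G s x - x‖ ≤ |s| * ‖L x‖ := fun s x =>
    le_of_tendsto_of_tendsto' ((hG s x).sub_const _).norm
      (((hL.tendsto_approx x).norm).const_mul _)
      fun n => norm_exp_smul_apply_sub_le (hskew n) s x
  have cont_zero : ∀ x, ContinuousAt (fun s : ℝ => G s x) 0 := fun x => by
    rw [Metric.continuousAt_iff]
    intro r hr
    obtain ⟨y, hy, hxy⟩ := Metric.dense_iff.1 hL.dense x (r / 3) (by positivity)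
    rw [Metric.mem_ball, dist_eq_norm] at hy
    refine ⟨r / 3 / (‖L ⟨y, hxy⟩‖ + 1), by positivity, fun s hs => ?_⟩
    rw [dist_zero_right, Real.norm_eq_abs, lt_div_iff₀ (by positivity)] at hs
    rw [dist_eq_norm, map_zero, one_apply_eq_self]
    have h1 := sub_le s ⟨y, hxy⟩
    have e : G s x - x = (G s y - y) - G s (y - x) + (y - x) := by rw [map_sub]; abel
    have h2 : ‖G s x - x‖ ≤ ‖G s y - y‖ + ‖y - x‖ + ‖y - x‖ := by
      rw [e]
      refine (norm_add_le _ _).trans (add_le_add ((norm_sub_le _ _).trans ?_) le_rfl)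
      rw [norm_map]
    have := abs_nonneg s
    simp only at h1
    linarith
  have cont : ∀ x, Continuous fun s : ℝ => G s x := fun x => by
    rw [continuous_iff_continuousAt]
    intro s
    have h : (fun r : ℝ => G r x) = fun r : ℝ => G s (G (r - s) x) := by
      funext r
      rw [← mul_apply_eq_comp, ← map_add, add_sub_cancel]
    rw [h]
    refine (G s).continuous.continuousAt.comp' ?_
    refine ContinuousAt.comp' (g := fun r => G r x) (f := fun r => r - s) ?_ (by fun_prop)
    rw [sub_self]
    exact cont_zero x
  have deriv : ∀ x : L.domain, HasDerivAt (fun s : ℝ => G s x) (L x) 0 := fun x => by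
    rw [hasDerivAt_iff_isLittleO, Asymptotics.isLittleO_iff]
    intro r hr
    -- `L x` need not lie in the domain. A nearby `y` in the domain is moved by the approximating
    -- groups at a speed bounded uniformly in the limit.
    obtain ⟨y, hy, hxy⟩ := Metric.dense_iff.1 hL.dense (L x) (r / 3) (by positivity)
    rw [Metric.mem_ball, dist_eq_norm] at hy
    have hsmall : ∀ᶠ t : ℝ in 𝓝 0, |t| * ‖L ⟨y, hxy⟩‖ < r / 3 := by
      have : Tendsto (fun t : ℝ => |t| * ‖L ⟨y, hxy⟩‖) (𝓝 0) (𝓝 0) := by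
        have : Continuous fun t : ℝ => |t| * ‖L ⟨y, hxy⟩‖ := by fun_prop
        simpa using this.tendsto 0
      exact this.eventually_lt_const (by positivity)
    filter_upwards [hsmall] with t ht
    rw [map_zero, one_apply_eq_self, sub_zero, Real.norm_eq_abs]
    have key : ‖G t x - x - t • L x‖ ≤
        (‖L x - L x‖ + ‖y - L x‖ + |t| * ‖L ⟨y, hxy⟩‖ + ‖y - L x‖) * |t| := by
      refine le_of_tendsto_of_tendsto' (((hG t x).sub_const _).sub_const _).norm
        (((((((hL.tendsto_approx x).sub_const _).norm).add_const _).add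
          (((hL.tendsto_approx ⟨y, hxy⟩).norm).const_mul _)).add_const _).mul_const _)
        fun n => norm_exp_smul_apply_sub_sub_le t (x : H) (L x) fun s hs => ?_
      set S := hL.approx (oneDivSucc n)
      have e : NormedSpace.exp (s • S) (S x) - L x =
          NormedSpace.exp (s • S) (S x - L x) - NormedSpace.exp (s • S) (y - L x)
            + (NormedSpace.exp (s • S) y - y) + (y - L x) := by
        rw [_root_.map_sub, _root_.map_sub]; abel
      rw [e]
      refine (norm_add_le _ _).trans (add_le_add ((norm_add_le _ _).trans (add_le_add
        ((norm_sub_le _ _).trans ?_) ?_)) le_rfl)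
      · rw [norm_exp_smul_apply (hskew n), norm_exp_smul_apply (hskew n)]
      · exact (norm_exp_smul_apply_sub_le (hskew n) s y).trans
          (mul_le_mul_of_nonneg_right hs (norm_nonneg _))
    refine key.trans (mul_le_mul_of_nonneg_right ?_ (abs_nonneg _))
    rw [sub_self, norm_zero]
    linarith
  refine ⟨G, map_zero, map_add, norm_map, cont, fun x y => ⟨fun h => ?_, fun h => ?_⟩⟩
  · obtain ⟨z, rfl, rfl⟩ := (LinearPMap.mem_graph_iff L).1 h
    exact deriv z
  -- The generator cannot be larger than `L`: with `z - Lz = x - y`, the vector `x - z` has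
  -- derivative `x - z` at `0`. Its norm is constant along the group, so it vanishes.
  · obtain ⟨z, hz⟩ := hL.surj 1 (x - y)
    rw [Units.val_one, Complex.ofReal_one, one_smul] at hz
    have hd : HasDerivAt (fun s : ℝ => G s (x - z)) (x - z) 0 := by
      have := h.sub (deriv z)
      have e : y - L z = x - z := by
        rw [sub_eq_sub_iff_add_eq_add] at hz ⊢
        rw [add_comm y, hz]
      rw [e] at this
      simp only [_root_.map_sub]
      exact this
    have h0 := hd.hasDerivWithinAt (s := univ) |>.normSq
    simp only [norm_map, map_zero, one_apply_eq_self] at h0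
    have h1 := (hasDerivWithinAt_univ.1 h0).unique (hasDerivAt_const 0 _)
    have h2 : (inner ℂ (x - (z : H)) (x - (z : H))).re = ‖x - (z : H)‖ ^ 2 :=
      inner_self_eq_norm_sq (𝕜 := ℂ) _
    rw [h2] at h1
    have h3 : x = z := sub_eq_zero.1 (norm_eq_zero.1 (by nlinarith))
    refine (LinearPMap.mem_graph_iff L).2 ⟨z, h3.symm, ?_⟩
    rw [h3] at hz
    simpa using hz

end IsMaximalSkew

end Stone


/-! ### Skew-adjoint operators are maximal skew-symmetric -/

section SkewAdjoint

variable {H : Type*} [NormedAddCommGroup H] [InnerProductSpace ℂ H]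

theorem IsSkewSymmetric.norm_sub_sq {L : H →ₗ.[ℂ] H} (hL : IsSkewSymmetric L) (ε : ℝ)
    (x : L.domain) :
    ‖(x : H) - (ε : ℂ) • L x‖ ^ 2 = ‖(x : H)‖ ^ 2 + ‖(ε : ℂ) • L x‖ ^ 2 := by
  have h := _root_.norm_sub_sq (𝕜 := ℂ) (x : H) ((ε : ℂ) • L x)
  rw [h, inner_smul_right, RCLike.re_to_complex, Complex.re_ofReal_mul, hL.re_inner_self]
  ring

variable [CompleteSpace H]

theorem IsSkewAdjoint.isSkewSymmetric {A : H →ₗ.[ℂ] H} (hA : IsSkewAdjoint A) :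
    IsSkewSymmetric A := by
  intro x y
  have h := LinearPMap.adjoint_isFormalAdjoint (T := A) hA.1
  rw [hA.2] at h
  have := h x y
  rw [LinearPMap.neg_apply, inner_neg_left] at this
  rw [← this, neg_neg]

/-- The range of `1 - εA` is closed, because its inverse is a contraction and the graph of the
adjoint is closed. It is dense, because `y` orthogonal to it satisfies `A*y = ε⁻¹y`, that is `(1 +
εA)y = 0`, and `1 + εA` is injective. -/
theorem IsSkewAdjoint.isMaximalSkew {A : H →ₗ.[ℂ] H} (hA : IsSkewAdjoint A) :
    IsMaximalSkew A := by
  have hs := hA.isSkewSymmetric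
  refine ⟨hA.1, hs, fun ε => ?_⟩
  have hε : ((ε : ℝ) : ℂ) ≠ 0 := by exact_mod_cast ε.ne_zero
  suffices h : LinearMap.range (oneSub A ε) = ⊤ from LinearMap.range_eq_top.1 h
  have hclosed : IsClosed (LinearMap.range (oneSub A ε) : Set H) := by
    rw [← isSeqClosed_iff_isClosed]
    intro y z hy hyz
    choose x hx using hy
    have hc : CauchySeq fun n => (x n : H) := by
      have h := hyz.cauchySeq
      rw [Metric.cauchySeq_iff] at h ⊢
      intro r hr
      obtain ⟨N, hN⟩ := h r hr
      refine ⟨N, fun m hm n hn => lt_of_le_of_lt ?_ (hN m hm n hn)⟩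
      rw [dist_eq_norm, dist_eq_norm, ← hx m, ← hx n, ← map_sub]
      exact hs.norm_le_norm_sub ε (x m - x n)
    obtain ⟨p, hp⟩ := cauchySeq_tendsto_of_complete hc
    have hneg : ∀ n, ((x n : H), ((ε : ℝ) : ℂ)⁻¹ • (y n - x n)) ∈ (A.adjoint).graph := fun n => by
      rw [hA.2, LinearPMap.mem_graph_iff]
      refine ⟨x n, rfl, ?_⟩
      rw [← hx n, oneSub_apply, LinearPMap.neg_apply, sub_sub_cancel_left, smul_neg, smul_smul,
        inv_mul_cancel₀ hε, one_smul]
    have hlim := (LinearPMap.adjoint_isClosed (T := A) hA.1).mem_of_tendsto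
      (hp.prodMk_nhds ((hyz.sub hp).const_smul _)) (Eventually.of_forall hneg)
    rw [SetLike.mem_coe, hA.2, LinearPMap.mem_graph_iff] at hlim
    obtain ⟨q, hq, hq'⟩ := hlim
    refine ⟨q, ?_⟩
    rw [LinearPMap.neg_apply] at hq'
    simp only at hq hq'
    rw [oneSub_apply, sub_eq_add_neg, ← smul_neg, hq', smul_smul, mul_inv_cancel₀ hε, one_smul,
      hq, add_sub_cancel]
  rw [← hclosed.submodule_topologicalClosure_eq, Submodule.topologicalClosure_eq_top_iff,
    Submodule.eq_bot_iff]
  intro y hy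
  have hy' : ∀ x : A.domain, inner ℂ (((ε : ℝ) : ℂ)⁻¹ • y) (x : H) = inner ℂ y (A x) := fun x => by
    have h := (Submodule.mem_orthogonal' _ _).1 hy (oneSub A ε x) ⟨x, rfl⟩
    rw [oneSub_apply, inner_sub_right, inner_smul_right, sub_eq_zero] at h
    rw [inner_smul_left, h, ← mul_assoc, map_inv₀, Complex.conj_ofReal, inv_mul_cancel₀ hε,
      one_mul]
  have hmem := LinearPMap.mem_adjoint_domain_of_exists (T := A) y ⟨_, hy'⟩
  have happ := LinearPMap.adjoint_apply_eq hA.1 ⟨y, hmem⟩ hy'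
  have hg : (y, ((ε : ℝ) : ℂ)⁻¹ • y) ∈ (A.adjoint).graph := by
    rw [LinearPMap.mem_graph_iff]; exact ⟨⟨y, hmem⟩, rfl, happ⟩
  rw [hA.2, LinearPMap.mem_graph_iff] at hg
  obtain ⟨q, hq, hq'⟩ := hg
  rw [LinearPMap.neg_apply] at hq'
  simp only at hq hq'
  have h := hs.norm_le_norm_sub (-ε) q
  rw [Units.val_neg, Complex.ofReal_neg, neg_smul, ← smul_neg, hq', smul_smul, mul_inv_cancel₀ hε,
    one_smul, hq, sub_self, norm_zero] at h
  exact norm_le_zero_iff.1 h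

end SkewAdjoint

/-! ### Relatively bounded perturbations -/

section Perturbation

variable {H : Type*} [NormedAddCommGroup H] [InnerProductSpace ℂ H]

/-- The operator `A + cT` with domain `D(A)`, for `T` defined on `D(A)`. -/
noncomputable def perturb (A : H →ₗ.[ℂ] H) (T : A.domain →ₗ[ℂ] H) (c : ℝ) : H →ₗ.[ℂ] H :=
  ⟨A.domain, A.toFun + (c : ℂ) • T⟩

theorem perturb_apply (A : H →ₗ.[ℂ] H) (T : A.domain →ₗ[ℂ] H) (c : ℝ) (x : A.domain) :
    (perturb A T c) x = A x + (c : ℂ) • T x := rfl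

theorem add_smul_eq_perturb {A B : H →ₗ.[ℂ] H} (h : A.domain ≤ B.domain) (c : ℝ) :
    A + (c : ℂ) • B = perturb A (B.toFun ∘ₗ Submodule.inclusion h) c := by
  refine LinearPMap.ext ?_ ?_
  · change A.domain ⊓ B.domain = A.domain
    exact inf_eq_left.2 h
  · intro x hx hy
    rfl

/-- `A` is a maximal skew-symmetric operator and `T` is skew-symmetric on `D(A)` and bounded
relatively to `A` with constant `a`. -/
structure IsSkewPerturbation (A : H →ₗ.[ℂ] H) (T : A.domain →ₗ[ℂ] H) (a : ℝ) : Prop where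
  maximalSkew : IsMaximalSkew A
  skew : ∀ x y : A.domain, inner ℂ (T x) (y : H) = -inner ℂ (x : H) (T y)
  bound : ∀ x, ‖T x‖ ≤ a * ‖A x‖

namespace IsSkewPerturbation

variable {A : H →ₗ.[ℂ] H} {T : A.domain →ₗ[ℂ] H} {a : ℝ} (h : IsSkewPerturbation A T a)
include h

theorem isSkewSymmetric_perturb (c : ℝ) : IsSkewSymmetric (perturb A T c) := by
  intro (x : A.domain) (y : A.domain)
  have h1 := h.maximalSkew.skew x y
  have h2 := h.skew x y
  rw [perturb_apply, perturb_apply, inner_add_left, inner_add_right, inner_smul_left,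
    inner_smul_right, h1, h2, Complex.conj_ofReal]
  ring

/-- With `R` the resolvent of `A`, `1 - ε(A + cT) = (1 - cεTR)(1 - εA)` on the domain. Pythagoras
gives `‖εARz‖ ≤ ‖z‖`, so `cεTR` has norm at most `|c|a < 1` for every `ε`, and the first factor is
inverted by a Neumann series. -/
theorem isMaximalSkew_perturb [CompleteSpace H] (ha : 0 ≤ a) {c : ℝ} (hc : |c| * a < 1) :
    IsMaximalSkew (perturb A T c) := by
  refine ⟨h.maximalSkew.dense, h.isSkewSymmetric_perturb c, fun ε y => ?_⟩
  have hmem : ∀ z, (h.maximalSkew.resolvent ε : H →ₗ[ℂ] H) z ∈ A.domain := fun z => by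
    obtain ⟨x, hx, -⟩ := h.maximalSkew.exists_resolvent_eq ε z
    exact hx ▸ x.2
  set R := LinearMap.codRestrict A.domain (h.maximalSkew.resolvent ε : H →ₗ[ℂ] H) hmem
  have hR : ∀ z, (R z : H) - ((ε : ℝ) : ℂ) • A (R z) = z := fun z => by
    obtain ⟨x, hx, hx'⟩ := h.maximalSkew.exists_resolvent_eq ε z
    have : R z = x := Subtype.ext hx
    rw [this, hx']
  have hAR : ∀ z, ‖((ε : ℝ) : ℂ) • A (R z)‖ ≤ ‖z‖ := fun z => by
    have := h.maximalSkew.skew.norm_sub_sq ε (R z)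
    rw [hR] at this
    exact le_of_sq_le_sq (by nlinarith [sq_nonneg ‖(R z : H)‖]) (norm_nonneg z)
  have hK : ∀ z, ‖((((c : ℂ) * ((ε : ℝ) : ℂ)) • T) ∘ₗ R) z‖ ≤ (|c| * a) * ‖z‖ := fun z => by
    have h1 := h.bound (R z)
    have h2 := hAR z
    change ‖((c : ℂ) * ((ε : ℝ) : ℂ)) • T (R z)‖ ≤ _
    rw [norm_smul, Complex.norm_real] at h2
    rw [norm_smul, norm_mul, Complex.norm_real, Complex.norm_real, Real.norm_eq_abs c]
    calc |c| * ‖(ε : ℝ)‖ * ‖T (R z)‖ ≤ |c| * ‖(ε : ℝ)‖ * (a * ‖A (R z)‖) := by gcongr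
      _ = (|c| * a) * (‖(ε : ℝ)‖ * ‖A (R z)‖) := by ring
      _ ≤ _ := by gcongr
  set K : H →L[ℂ] H := (((((c : ℂ) * ((ε : ℝ) : ℂ)) • T) ∘ₗ R)).mkContinuous (|c| * a) hK
  have hKn : ‖K‖ < 1 := (LinearMap.mkContinuous_norm_le _ (by positivity) _).trans_lt hc
  obtain ⟨V, hV⟩ := (isUnit_one_sub_of_norm_lt_one hKn).exists_right_inv
  have hz : V y - K (V y) = y := by
    have := congrArg (fun F : H →L[ℂ] H => F y) hV
    simpa using this
  refine ⟨R (V y), ?_⟩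
  have hKV : K (V y) = ((c : ℂ) * ((ε : ℝ) : ℂ)) • T (R (V y)) := rfl
  have h1 := hR (V y)
  rw [hKV] at hz
  rw [perturb_apply, smul_add, smul_smul, ← sub_sub, h1, mul_comm ((ε : ℝ) : ℂ)]
  exact hz

theorem norm_perturb_le {c : ℝ} (hc : |c| * a ≤ 1) (x : A.domain) :
    ‖perturb A T c x‖ ≤ 2 * ‖A x‖ := by
  rw [perturb_apply]
  refine (norm_add_le _ _).trans ?_
  rw [norm_smul, Complex.norm_real, Real.norm_eq_abs]
  have := mul_le_mul_of_nonneg_left (h.bound x) (abs_nonneg c)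
  nlinarith [norm_nonneg (A x)]

theorem le_norm_perturb {δ c : ℝ} (hc : |c| * a ≤ 1 - δ) (x : A.domain) :
    δ * ‖A x‖ ≤ ‖perturb A T c x‖ := by
  rw [perturb_apply]
  have h1 : ‖A x‖ - ‖(c : ℂ) • T x‖ ≤ ‖A x + (c : ℂ) • T x‖ := by
    have := norm_sub_norm_le (A x) (-((c : ℂ) • T x))
    rwa [norm_neg, sub_neg_eq_add] at this
  rw [norm_smul, Complex.norm_real, Real.norm_eq_abs] at h1
  have := mul_le_mul_of_nonneg_left (h.bound x) (abs_nonneg c)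
  nlinarith [norm_nonneg (A x)]

/-- The factor `1 + (a/δ)|d - c|` is relaxed to an exponential so that successive switches add up to
a variation. -/
theorem norm_perturb_le_exp (ha : 0 ≤ a) {δ c d : ℝ} (hδ : 0 < δ) (hc : |c| * a ≤ 1 - δ)
    (x : A.domain) :
    ‖perturb A T d x‖ ≤ Real.exp (a / δ * |d - c|) * ‖perturb A T c x‖ := by
  have e : perturb A T d x = perturb A T c x + ((d - c : ℝ) : ℂ) • T x := by
    rw [perturb_apply, perturb_apply]; push_cast; module
  have h1 : ‖T x‖ ≤ a / δ * ‖perturb A T c x‖ := by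
    rw [div_mul_eq_mul_div, le_div_iff₀ hδ]
    have h2 := mul_le_mul_of_nonneg_left (h.le_norm_perturb hc x) ha
    have h3 := mul_le_mul_of_nonneg_right (h.bound x) hδ.le
    linarith
  calc ‖perturb A T d x‖ ≤ ‖perturb A T c x‖ + |d - c| * (a / δ * ‖perturb A T c x‖) := by
        rw [e]
        refine (norm_add_le _ _).trans (add_le_add le_rfl ?_)
        rw [norm_smul, Complex.norm_real, Real.norm_eq_abs]
        exact mul_le_mul_of_nonneg_left h1 (abs_nonneg _)
    _ = (a / δ * |d - c| + 1) * ‖perturb A T c x‖ := by ring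
    _ ≤ _ := mul_le_mul_of_nonneg_right (Real.add_one_le_exp _) (norm_nonneg _)

end IsSkewPerturbation

end Perturbation

/-! ### Invariance of the domain and phases for unitary groups -/

section Groups

variable {H : Type*} [NormedAddCommGroup H] [InnerProductSpace ℂ H]

namespace IsUnitaryGroupOf

variable {L : H →ₗ.[ℂ] H} {G : ℝ → H →L[ℂ] H} (hG : IsUnitaryGroupOf L G)
include hG

theorem hasDerivAt (s : ℝ) (x : L.domain) : HasDerivAt (fun r : ℝ => G r x) (G s (L x)) s := by
  have h0 : HasDerivAt (fun r : ℝ => G r x) (L x) (s - s) := by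
    rw [sub_self]
    exact (hG.generator _ _).1 (L.mem_graph x)
  have h1 := ((G s).restrictScalars ℝ).hasFDerivAt.comp_hasDerivAt s (h0.comp_sub_const s s)
  have e : (fun r : ℝ => G r x) = fun r : ℝ => G s (G (r - s) x) := by
    funext r
    rw [← mul_apply_eq_comp, ← hG.map_add, add_sub_cancel]
  rw [e]
  exact h1

/-- `G s` commutes with the difference quotients of the group, and the domain consists exactly of
the vectors where these converge. -/
theorem exists_apply_eq (s : ℝ) (x : L.domain) :
    ∃ z : L.domain, G s x = z ∧ L z = G s (L x) := by
  have h0 := (hG.generator _ _).1 (L.mem_graph x)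
  have h1 := ((G s).restrictScalars ℝ).hasFDerivAt.comp_hasDerivAt 0 h0
  have e : ∀ r, G s (G r x) = G r (G s x) := fun r => by
    rw [← mul_apply_eq_comp, ← mul_apply_eq_comp, ← hG.map_add, ← hG.map_add, add_comm]
  have h2 : HasDerivAt (fun r : ℝ => G r (G s x)) (G s (L x)) 0 := by
    simp only [← e]
    exact h1
  obtain ⟨z, hz, hz'⟩ := (LinearPMap.mem_graph_iff L).1 ((hG.generator _ _).2 h2)
  exact ⟨z, hz.symm, hz'⟩

/-- Adding `iλ` to the generator multiplies the group by `e^{iλs}`. -/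
theorem exp_smul {L' : H →ₗ.[ℂ] H} {lam : ℝ}
    (hL' : ∀ x y : H, (x, y) ∈ L'.graph ↔ (x, y - (Complex.I * (lam : ℂ)) • x) ∈ L.graph) :
    IsUnitaryGroupOf L' fun s => Complex.exp (Complex.I * (lam : ℂ) * (s : ℂ)) • G s := by
  have hderiv : ∀ μ : ℝ, HasDerivAt (fun s : ℝ => Complex.exp (Complex.I * (μ : ℂ) * (s : ℂ)))
      (Complex.I * (μ : ℂ)) 0 := fun μ => by
    have h := ((hasDerivAt_id (0 : ℝ)).ofReal_comp.const_mul (Complex.I * (μ : ℂ))).cexp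
    simpa using h
  have key : ∀ (F : ℝ → H →L[ℂ] H) (μ : ℝ) (x y : H), F 0 = 1 →
      HasDerivAt (fun s : ℝ => F s x) y 0 →
      HasDerivAt (fun s : ℝ => Complex.exp (Complex.I * (μ : ℂ) * (s : ℂ)) • F s x)
        (y + (Complex.I * (μ : ℂ)) • x) 0 := fun F μ x y hF h => by
    have := (hderiv μ).fun_smul h
    simpa [hF] using this
  have hcont : Continuous fun s : ℝ => Complex.exp (Complex.I * (lam : ℂ) * (s : ℂ)) := by
    fun_prop
  refine ⟨by simp [hG.map_zero], fun s t => ?_, fun s x => ?_, fun x => ?_, fun x y => ?_⟩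
  · rw [hG.map_add, smul_mul_smul_comm, ← Complex.exp_add]
    congr 2
    push_cast
    ring
  · rw [smul_apply, norm_smul, hG.norm_map, mul_assoc, ← Complex.ofReal_mul, mul_comm,
      mul_comm Complex.I, Complex.norm_exp_ofReal_mul_I, mul_one]
  · exact hcont.smul (hG.strongly_continuous x)
  · rw [hL', hG.generator]
    refine ⟨fun h => ?_, fun h => ?_⟩
    · have := key G lam x _ hG.map_zero h
      rwa [sub_add_cancel] at this
    -- The converse is the same computation with the opposite phase applied to the new group.
    · have := key _ (-lam) x y (by simp [hG.map_zero]) h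
      simp only [smul_apply, smul_smul, ← Complex.exp_add] at this
      simpa [← sub_eq_add_neg] using this

end IsUnitaryGroupOf

end Groups


/-! ### Rounding down to a finite set -/

section FinitePoints

/-- The largest point `p ≤ s` of `P ∪ {0}`, for a finite set `P` of nonnegative reals (and `0` when
`s ≤ 0`). -/
noncomputable def floorIn (P : Finset ℝ) (s : ℝ) : ℝ :=
  (insert 0 P).sup' (Finset.insert_nonempty 0 P) fun p => if p ≤ s then p else 0

variable {P : Finset ℝ}

theorem floorIn_le {s : ℝ} (hs : 0 ≤ s) : floorIn P s ≤ s := by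
  refine Finset.sup'_le _ _ fun p _ => ?_
  split_ifs with h <;> assumption

theorem floorIn_nonneg (P : Finset ℝ) (s : ℝ) : 0 ≤ floorIn P s :=
  le_trans (by simp) (Finset.le_sup' (fun p => if p ≤ s then p else 0) (Finset.mem_insert_self 0 P))

theorem floorIn_of_nonpos {s : ℝ} (hs : s ≤ 0) : floorIn P s = 0 := by
  refine le_antisymm (Finset.sup'_le _ _ fun p hp => ?_) (floorIn_nonneg P s)
  split_ifs with h
  · exact h.trans hs
  · exact le_rfl

theorem le_floorIn {p s : ℝ} (hp : p ∈ P) (hps : p ≤ s) : p ≤ floorIn P s :=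
  le_trans (by simp [hps])
    (Finset.le_sup' (fun p => if p ≤ s then p else 0) (Finset.mem_insert_of_mem hp))

/-- Composition with a monotone map does not increase the variation, so `u ∘ floorIn P` varies no
more than `u`. -/
theorem floorIn_mono (hP : ∀ p ∈ P, 0 ≤ p) : Monotone (floorIn P) := by
  intro s r hsr
  refine Finset.sup'_mono_fun fun p hp => ?_
  have h0 : 0 ≤ p := by
    rcases Finset.mem_insert.1 hp with rfl | h
    exacts [le_rfl, hP p h]
  split_ifs with h1 h2 h2
  · exact le_rfl
  · exact absurd (h1.trans hsr) h2
  · exact h0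
  · exact le_rfl

theorem floorIn_congr {s r : ℝ} (h : ∀ p ∈ P, p ≤ s ↔ p ≤ r) : floorIn P s = floorIn P r := by
  refine Finset.sup'_congr _ rfl fun p hp => ?_
  rcases Finset.mem_insert.1 hp with rfl | hp
  · simp
  · simp only [h p hp]

/-- A function that is constant between the points of a finite set is a step function. -/
theorem exists_isStepOn {v : ℝ → ℝ} (P : Finset ℝ)
    (hv : ∀ s r : ℝ, (∀ p ∈ P, p ≤ s ↔ p ≤ r) → v s = v r) {T : ℝ} (hT : 0 ≤ T) :
    ∃ (N : ℕ) (τ c : ℕ → ℝ), IsStepOn v T N τ c := by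
  classical
  set Q : Finset ℝ := insert 0 (insert T (P.filter fun p => p ∈ Icc 0 T)) with hQ
  have h0 : (0 : ℝ) ∈ Q := by simp [hQ]
  have hTQ : T ∈ Q := by simp [hQ]
  have hQT : ∀ q ∈ Q, 0 ≤ q ∧ q ≤ T := fun q hq => by
    simp only [hQ, Finset.mem_insert, Finset.mem_filter] at hq
    rcases hq with rfl | rfl | ⟨-, h⟩
    exacts [⟨le_rfl, hT⟩, ⟨hT, le_rfl⟩, h]
  have hcard : 0 < Q.card := Finset.card_pos.2 ⟨0, h0⟩
  set e := Q.orderEmbOfFin rfl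
  have hmem : ∀ i, e i ∈ Q := Finset.orderEmbOfFin_mem Q rfl
  have hsurj : ∀ q ∈ Q, ∃ i, e i = q := fun q hq => by
    have : q ∈ Set.range e := by rw [Finset.range_orderEmbOfFin]; exact hq
    exact this
  -- The default `0` is never reached: only indices up to `Q.card - 1` occur.
  set τ : ℕ → ℝ := fun k => if h : k < Q.card then e ⟨k, h⟩ else 0
  have hτ : ∀ k (h : k < Q.card), τ k = e ⟨k, h⟩ := fun k h => dif_pos h
  refine ⟨Q.card - 1, τ, fun k => v ((τ k + τ (k + 1)) / 2), ?_, ?_, fun k hk => ?_⟩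
  · obtain ⟨i, hi⟩ := hsurj 0 h0
    rw [hτ 0 hcard]
    refine le_antisymm ?_ (hQT _ (hmem _)).1
    rw [← hi]
    exact e.monotone (Nat.zero_le _)
  · obtain ⟨i, hi⟩ := hsurj T hTQ
    rw [hτ _ (by omega)]
    refine le_antisymm (hQT _ (hmem _)).2 ?_
    exact hi.symm.le.trans (e.monotone (Nat.le_sub_one_of_lt i.2))
  · have hk1 : k + 1 < Q.card := by omega
    have hlt : τ k < τ (k + 1) := by
      rw [hτ k (by omega), hτ _ hk1]
      exact e.strictMono (by simp [Fin.lt_def])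
    refine ⟨hlt, fun s hs => hv _ _ fun p hp => ?_⟩
    have hno : ¬ (τ k < p ∧ p < τ (k + 1)) := by
      rintro ⟨h1, h2⟩
      rw [hτ k (by omega)] at h1
      rw [hτ _ hk1] at h2
      obtain ⟨i, hi⟩ := hsurj p (by
        simp only [hQ, Finset.mem_insert, Finset.mem_filter]
        exact Or.inr (Or.inr ⟨hp, (hQT _ (hmem _)).1.trans h1.le, h2.le.trans (hQT _ (hmem _)).2⟩))
      rw [← hi] at h1 h2
      have h3 := e.lt_iff_lt.1 h1
      have h4 := e.lt_iff_lt.1 h2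
      simp only [Fin.lt_def] at h3 h4
      omega
    obtain ⟨hs1, hs2⟩ := hs
    constructor <;> intro h <;> by_contra! h' <;> exact hno ⟨by linarith, by linarith⟩

end FinitePoints

/-! ### Step approximation of controls of bounded variation -/

section Approximation

theorem exists_monotone_sub {u : ℝ → ℝ} (hu : BoundedVariationOn u univ) :
    ∃ p q : ℝ → ℝ, Monotone p ∧ Monotone q ∧ u = p - q := by
  obtain ⟨p, q, hp, hq, h⟩ :=
    hu.locallyBoundedVariationOn.exists_monotoneOn_sub_monotoneOn
  exact ⟨p, q, monotoneOn_univ.1 hp, monotoneOn_univ.1 hq, h⟩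

theorem measurable_of_boundedVariationOn {u : ℝ → ℝ} (hu : BoundedVariationOn u univ) :
    Measurable u := by
  obtain ⟨p, q, hp, hq, rfl⟩ := exists_monotone_sub hu
  exact hp.measurable.sub hq.measurable

theorem countable_not_continuousAt_of_boundedVariationOn {u : ℝ → ℝ}
    (hu : BoundedVariationOn u univ) : {x | ¬ ContinuousAt u x}.Countable := by
  obtain ⟨p, q, hp, hq, rfl⟩ := exists_monotone_sub hu
  refine (hp.countable_not_continuousAt.union hq.countable_not_continuousAt).mono fun x hx => ?_
  by_contra h
  simp only [mem_union, mem_ofPred_eq, not_or, not_not] at h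
  exact hx (h.1.sub h.2)

/-- Controls of bounded variation are pointwise limits of step controls of smaller variation. -/
theorem exists_isApproximation {δ a : ℝ} {u : ℝ → ℝ} (hu : u ∈ boundedControls δ a) (T : ℝ) :
    ∃ v : ℕ → ℝ → ℝ, IsApproximation δ a T u v := by
  classical
  obtain ⟨⟨hbv, hu0⟩, hIoo⟩ := hu
  -- The discontinuities of `u` eventually become sample points, where the approximation is exact.
  -- The rationals make the rounding converge to `s`, which suffices where `u` is continuous.
  set S : Set ℝ := ({x | ¬ ContinuousAt u x} ∪ range ((↑) : ℚ → ℝ)) ∩ Ici 0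
  have hS : S.Countable := ((countable_not_continuousAt_of_boundedVariationOn hbv).union
    (countable_range _)).mono inter_subset_left
  obtain ⟨e, he⟩ := hS.exists_eq_range ⟨0, Or.inr ⟨0, by simp⟩, mem_Ici.2 le_rfl⟩
  set P : ℕ → Finset ℝ := fun n => (Finset.range n).image e
  have hP : ∀ n, ∀ p ∈ P n, 0 ≤ p := fun n p hp => by
    obtain ⟨i, -, rfl⟩ := Finset.mem_image.1 hp
    have : e i ∈ S := he ▸ mem_range_self i
    exact this.2
  have hmemP : ∀ p ∈ S, ∀ᶠ n in atTop, p ∈ P n := fun p hp => by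
    rw [he] at hp
    obtain ⟨i, rfl⟩ := hp
    filter_upwards [eventually_gt_atTop i] with n hn
    exact Finset.mem_image_of_mem e (Finset.mem_range.2 hn)
  refine ⟨fun n => u ∘ floorIn (P n), fun n => ⟨⟨?_, fun t ht => ?_⟩, fun t => hIoo _⟩,
    fun n R hR => exists_isStepOn (P n) (fun s r h => congrArg u (floorIn_congr h)) hR,
    fun s => ?_, fun n => ?_⟩
  · exact ne_top_of_le_ne_top hbv (eVariationOn.comp_le_of_monotoneOn u _
      ((floorIn_mono (hP n)).monotoneOn _) (mapsTo_univ _ _))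
  · rw [Function.comp_apply, floorIn_of_nonpos ht, hu0 0 le_rfl]
  · rcases le_or_gt s 0 with hs | hs
    · refine tendsto_const_nhds.congr fun n => ?_
      rw [Function.comp_apply, floorIn_of_nonpos hs, hu0 0 le_rfl, hu0 s hs]
    by_cases hc : ContinuousAt u s
    · refine hc.tendsto.comp ?_
      rw [tendsto_order]
      refine ⟨fun b hb => ?_, fun b hb => Eventually.of_forall fun n =>
        (floorIn_le hs.le).trans_lt hb⟩
      obtain ⟨q, hq1, hq2⟩ := exists_rat_btwn (max_lt hb hs)
      filter_upwards [hmemP q ⟨Or.inr ⟨q, rfl⟩, ((le_max_right _ _).trans_lt hq1).le⟩] with n hn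
      exact ((le_max_left _ _).trans_lt hq1).trans_le (le_floorIn hn hq2.le)
    · refine tendsto_const_nhds.congr' ?_
      filter_upwards [hmemP s ⟨Or.inl hc, hs.le⟩] with n hn
      rw [Function.comp_apply,
        le_antisymm (floorIn_le hs.le) (le_floorIn hn le_rfl)]
  · exact eVariationOn.comp_le_of_monotoneOn u _ ((floorIn_mono (hP n)).monotoneOn _)
      fun s hs => ⟨floorIn_nonneg (P n) s, (floorIn_le hs.1).trans hs.2⟩

theorem IsStepOn.monotoneOn {v : ℝ → ℝ} {T : ℝ} {N : ℕ} {τ c : ℕ → ℝ} (h : IsStepOn v T N τ c) :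
    MonotoneOn τ (Iic N) := by
  intro i _ j hj hij
  induction j, hij using Nat.le_induction with
  | base => exact le_rfl
  | succ k hik ih => exact (ih ((Nat.le_succ k).trans hj)).trans (h.2.2 k hj).1.le

/-- The values of a step function form a path whose length is at most the total variation. -/
theorem IsStepOn.sum_abs_sub_le {v : ℝ → ℝ} {T V : ℝ} {N : ℕ} {τ c : ℕ → ℝ}
    (h : IsStepOn v T N τ c) (hV : 0 ≤ V)
    (hvar : eVariationOn v (Icc 0 T) ≤ ENNReal.ofReal V) {k : ℕ} (hk : k < N) :
    ∑ j ∈ Finset.range k, |c (j + 1) - c j| ≤ V := by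
  -- Sampling at midpoints avoids the switching times, where `v` is arbitrary.
  set m : ℕ → ℝ := fun j => (τ j + τ (j + 1)) / 2
  have hm : ∀ j < N, τ j < m j ∧ m j < τ (j + 1) := fun j hj => by
    have := (h.2.2 j hj).1
    constructor <;> simp only [m] <;> linarith
  have hvm : ∀ j < N, v (m j) = c j := fun j hj => (h.2.2 j hj).2 _ (hm j hj)
  have hmono : MonotoneOn m (Iic k) := by
    intro i hi j hj hij
    rw [mem_Iic] at hi hj
    have h1 := h.monotoneOn (mem_Iic.2 (by omega)) (mem_Iic.2 (by omega)) hij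
    have h2 := h.monotoneOn (mem_Iic.2 (by omega)) (mem_Iic.2 (by omega))
      (Nat.add_le_add_right hij 1)
    simp only [m]
    linarith
  have hmT : ∀ i ≤ k, m i ∈ Icc 0 T := fun i hi => by
    have hi' := hm i (by omega)
    have h1 := h.monotoneOn (mem_Iic.2 (Nat.zero_le N)) (mem_Iic.2 (by omega : i ≤ N))
      (Nat.zero_le i)
    have h2 := h.monotoneOn (mem_Iic.2 (by omega : i + 1 ≤ N)) (mem_Iic.2 (le_refl N))
      (by omega)
    rw [h.1] at h1
    rw [h.2.1] at h2
    exact ⟨by linarith, by linarith⟩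
  have hsum := (eVariationOn.sum_le_of_monotoneOn_Iic (f := v) hmono hmT).trans hvar
  rw [← ENNReal.ofReal_le_ofReal_iff hV, ENNReal.ofReal_sum_of_nonneg fun _ _ => abs_nonneg _]
  refine le_of_eq_of_le (Finset.sum_congr rfl fun j hj => ?_) hsum
  rw [Finset.mem_range] at hj
  rw [edist_dist, Real.dist_eq, hvm j (by omega), hvm (j + 1) (by omega)]

theorem IsStepOn.value_mem {v : ℝ → ℝ} {T : ℝ} {N : ℕ} {τ c : ℕ → ℝ} (h : IsStepOn v T N τ c)
    {s : Set ℝ} (hv : ∀ t, v t ∈ s) {k : ℕ} (hk : k < N) : c k ∈ s := by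
  obtain ⟨h1, h2⟩ := h.2.2 k hk
  rw [← h2 ((τ k + τ (k + 1)) / 2) ⟨by linarith, by linarith⟩]
  exact hv _

end Approximation


/-! ### Trajectories of step controls and the energy estimate -/

section Trajectories

variable {H : Type*} [NormedAddCommGroup H] [InnerProductSpace ℂ H]

/-- `x` solves `x' = (A + v T) x` on `[0, t)`, away from finitely many times, in the sense of right
derivatives, with `x 0 = ψ`, with constant norm and with `‖A x‖ ≤ M`. -/
structure IsTrajectory (A : H →ₗ.[ℂ] H) (T : A.domain →ₗ[ℂ] H) (v : ℝ → ℝ) (t : ℝ) (ψ : H) (M : ℝ)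
    (x : ℝ → H) (w : ℝ → ℝ) : Prop where
  continuousOn : ContinuousOn x (Icc 0 t)
  zero : x 0 = ψ
  finite : {s | s ∈ Ico 0 t ∧ w s ≠ v s}.Finite
  solves : ∀ s ∈ Ico 0 t, ∃ z : A.domain, x s = z ∧
    HasDerivWithinAt x (A z + (w s : ℂ) • T z) (Ioi s) s ∧ ‖A z‖ ≤ M ∧ ‖x s‖ = ‖ψ‖

variable {A : H →ₗ.[ℂ] H} {T : A.domain →ₗ[ℂ] H} {a : ℝ}

theorem norm_concatenation {G : ℕ → ℝ → H →L[ℂ] H} {τ : ℕ → ℝ} {k : ℕ}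
    (hG : ∀ j < k, ∀ s x, ‖G j s x‖ = ‖x‖) (x : H) : ‖concatenation G τ k x‖ = ‖x‖ := by
  induction k with
  | zero => rfl
  | succ k ih =>
    rw [concatenation, mul_apply_eq_comp, hG k k.lt_succ_self]
    exact ih fun j hj => hG j (hj.trans k.lt_succ_self)

/-- Each group commutes with its own generator, so `‖(A + c k T)z‖` is conserved on a piece;
`norm_perturb_le_exp` pays for each switch. The factor `2` bounds the first piece in terms of `A`.
-/
theorem IsSkewPerturbation.exists_concatenation (h : IsSkewPerturbation A T a) (ha : 0 ≤ a)
    {δ : ℝ} (hδ : 0 < δ) {N : ℕ} {τ c : ℕ → ℝ} {G : ℕ → ℝ → H →L[ℂ] H}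
    (hc : ∀ k < N, |c k| * a ≤ 1 - δ)
    (hG : ∀ k < N, IsUnitaryGroupOf (perturb A T (c k)) (G k)) (ψ : A.domain) {k : ℕ} (hk : k < N) :
    ∃ z : A.domain, concatenation G τ k ψ = z ∧ ‖perturb A T (c k) z‖ ≤
      Real.exp (a / δ * ∑ j ∈ Finset.range k, |c (j + 1) - c j|) * (2 * ‖A ψ‖) := by
  induction k with
  | zero =>
    refine ⟨ψ, rfl, ?_⟩
    simpa using h.norm_perturb_le (by linarith [hc 0 hk]) ψ
  | succ k ih =>
    obtain ⟨z, hz, hle⟩ := ih (by omega)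
    have hk' : k < N := by omega
    obtain ⟨y, hy, hy'⟩ := (hG k hk').exists_apply_eq (τ (k + 1) - τ k) z
    refine ⟨y, by rw [concatenation, mul_apply_eq_comp, hz, hy], ?_⟩
    have h1 := h.norm_perturb_le_exp ha hδ (d := c (k + 1)) (hc k hk') y
    rw [hy', (hG k hk').norm_map] at h1
    refine h1.trans ?_
    rw [Finset.sum_range_succ, mul_add, Real.exp_add]
    calc _ ≤ _ := mul_le_mul_of_nonneg_left hle (Real.exp_nonneg _)
      _ = _ := by ring

theorem IsSkewPerturbation.exists_isTrajectory (h : IsSkewPerturbation A T a) (ha : 0 ≤ a)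
    {δ : ℝ} (hδ : 0 < δ) {v : ℝ → ℝ} {t V : ℝ} {N : ℕ} {τ c : ℕ → ℝ} {G : ℕ → ℝ → H →L[ℂ] H}
    (hv : IsStepOn v t N τ c) (hc : ∀ k < N, |c k| * a ≤ 1 - δ)
    (hV : 0 ≤ V) (hvar : eVariationOn v (Icc 0 t) ≤ ENNReal.ofReal V)
    (hG : ∀ k < N, IsUnitaryGroupOf (perturb A T (c k)) (G k)) (ψ : A.domain) :
    ∃ (x : ℝ → H) (w : ℝ → ℝ),
      IsTrajectory A T v t ψ (Real.exp (a / δ * V) * (2 * ‖A ψ‖) / δ) x w ∧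
      x t = concatenation G τ N ψ := by
  set M := Real.exp (a / δ * V) * (2 * ‖A ψ‖) / δ
  suffices hind : ∀ k ≤ N, 0 ≤ τ k ∧ ∃ (x : ℝ → H) (w : ℝ → ℝ),
      IsTrajectory A T v (τ k) ψ M x w ∧ x (τ k) = concatenation G τ k ψ by
    have := (hind N le_rfl).2
    rwa [hv.2.1] at this
  intro k hk
  induction k with
  | zero =>
    rw [hv.1]
    refine ⟨le_rfl, fun _ => ψ, 0, ⟨continuousOn_const, rfl, ?_, fun s hs => ?_⟩, rfl⟩
    · simp
    · simp at hs
  | succ k ih =>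
    obtain ⟨h0, x, w, hx, hxk⟩ := ih (by omega)
    have hk' : k < N := by omega
    obtain ⟨hτ, hvc⟩ := hv.2.2 k hk'
    obtain ⟨z, hz, hzle⟩ := h.exists_concatenation (τ := τ) ha hδ hc hG ψ hk'
    set y : ℝ → H := fun s => G k (s - τ k) z with hy
    have hyd : ∀ s, ∃ p : A.domain, y s = p ∧
        HasDerivAt y (A p + (c k : ℂ) • T p) s ∧ ‖A p‖ ≤ M := fun s => by
      obtain ⟨p, hp, hp'⟩ := (hG k hk').exists_apply_eq (s - τ k) z
      refine ⟨p, hp, ?_, ?_⟩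
      · change HasDerivAt y (perturb A T (c k) p) s
        rw [hp']
        exact ((hG k hk').hasDerivAt (s - τ k) z).comp_sub_const s (τ k)
      · have h1 := h.le_norm_perturb (hc k hk') p
        rw [hp', (hG k hk').norm_map] at h1
        rw [le_div_iff₀ hδ, mul_comm]
        refine h1.trans (hzle.trans ?_)
        have h2 := hv.sum_abs_sub_le hV hvar hk'
        gcongr
    have hnormz : ‖(z : H)‖ = ‖(ψ : H)‖ := by
      rw [← hz]
      exact norm_concatenation (fun j hj => (hG j (by omega)).norm_map) _
    have hyk : y (τ k) = x (τ k) := by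
      simp only [hy, sub_self, (hG k hk').map_zero, hxk, hz, one_apply_eq_self]
    set X : ℝ → H := fun s => if s ≤ τ k then x s else y s with hX
    have hXx : ∀ s, s ≤ τ k → X s = x s := fun s hs => if_pos hs
    have hXy : ∀ s, τ k ≤ s → X s = y s := fun s hs => by
      rcases hs.eq_or_lt with rfl | hs
      · rw [hXx _ le_rfl, hyk]
      · exact if_neg (not_le.2 hs)
    -- At `τ k` the right derivative already belongs to the new piece, hence the strict inequality.
    -- The value of `v` there is free, so `τ k` may join the exceptional times.
    refine ⟨h0.trans hτ.le, X, fun s => if s < τ k then w s else c k, ⟨?_, ?_, ?_, ?_⟩, ?_⟩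
    · rw [← Icc_union_Icc_eq_Icc h0 hτ.le]
      refine ContinuousOn.union_of_isClosed ?_ ?_ isClosed_Icc isClosed_Icc
      · exact hx.continuousOn.congr fun s hs => hXx s hs.2
      · refine ContinuousOn.congr (f := y) (fun s _ => ?_) fun s hs => hXy s hs.1
        obtain ⟨p, -, hp, -⟩ := hyd s
        exact hp.continuousAt.continuousWithinAt
    · rw [hXx 0 h0, hx.zero]
    · refine (hx.finite.union (finite_singleton (τ k))).subset ?_
      rintro s ⟨hs, hne⟩
      by_cases hsk : s < τ k
      · simp only [if_pos hsk] at hne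
        exact Or.inl ⟨⟨hs.1, hsk⟩, hne⟩
      · simp only [if_neg hsk] at hne
        refine Or.inr (le_antisymm ?_ (not_lt.1 hsk))
        by_contra! hlt
        exact hne (hvc s ⟨hlt, hs.2⟩).symm
    · intro s hs
      by_cases hsk : s < τ k
      · obtain ⟨p, hp, hd, hM, hn⟩ := hx.solves s ⟨hs.1, hsk⟩
        refine ⟨p, by rw [hXx s hsk.le, hp], ?_, hM, by rw [hXx s hsk.le, hn]⟩
        simp only [if_pos hsk]
        refine hd.congr_of_eventuallyEq ?_ (hXx s hsk.le)
        filter_upwards [mem_nhdsWithin_of_mem_nhds (Iio_mem_nhds hsk)] with r hr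
        exact hXx r (le_of_lt hr)
      · obtain ⟨p, hp, hd, hM⟩ := hyd s
        have hsk' := not_lt.1 hsk
        refine ⟨p, by rw [hXy s hsk', hp], ?_, hM, ?_⟩
        · simp only [if_neg hsk]
          exact hd.hasDerivWithinAt.congr (fun r hr => hXy r (hsk'.trans (le_of_lt hr)))
            (hXy s hsk')
        · rw [hXy s hsk', hy, ← hnormz]
          exact (hG k hk').norm_map _ _
    · rw [hXy _ hτ.le, hy, concatenation, mul_apply_eq_comp, hz]

/-- Two trajectories with the same initial value are close when their controls are close in `L¹`. -/
theorem IsSkewPerturbation.norm_sub_sq_le (h : IsSkewPerturbation A T a) (ha : 0 ≤ a)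
    {v v' : ℝ → ℝ} {t M : ℝ} {ψ : H} {x x' : ℝ → H} {w w' : ℝ → ℝ} (ht : 0 ≤ t)
    (hx : IsTrajectory A T v t ψ M x w) (hx' : IsTrajectory A T v' t ψ M x' w')
    (hint : MeasureTheory.IntegrableOn (fun s => |v s - v' s|) (Icc 0 t)) :
    ‖x t - x' t‖ ^ 2 ≤ (4 * ‖ψ‖ * (a * M)) * ∫ s in (0 : ℝ)..t, |v s - v' s| := by
  -- A factor `2` comes from differentiating the square, `2‖ψ‖` bounds `‖x - x'‖`, and `aM` bounds
  -- `‖Tx'‖`.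
  set C := 4 * ‖ψ‖ * (a * M)
  have hd : ∀ s, ∃ g : ℝ, s ∈ Ico 0 t →
      HasDerivWithinAt (fun r => ‖x r - x' r‖ ^ 2) g (Ioi s) s ∧ g ≤ C * |w s - w' s| := by
    intro s
    by_cases hs : s ∈ Ico 0 t
    swap
    · exact ⟨0, fun hs' => absurd hs' hs⟩
    obtain ⟨z, hz, hzd, -, hzn⟩ := hx.solves s hs
    obtain ⟨z', hz', hzd', hM, hzn'⟩ := hx'.solves s hs
    refine ⟨_, fun _ => ⟨(hzd.sub hzd').normSq, ?_⟩⟩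
    -- The first summand is a skew operator applied to the difference and contributes nothing to the
    -- energy.
    have e : A z + (w s : ℂ) • T z - (A z' + (w' s : ℂ) • T z') =
        perturb A T (w s) (z - z') + ((w s - w' s : ℝ) : ℂ) • T z' := by
      rw [perturb_apply, LinearPMap.map_sub, map_sub]
      push_cast
      module
    have hself : (inner ℂ ((z : H) - z') (perturb A T (w s) (z - z'))).re = 0 :=
      (h.isSkewSymmetric_perturb (w s)).re_inner_self (z - z')
    have hTM : ‖T z'‖ ≤ a * M := (h.bound z').trans (mul_le_mul_of_nonneg_left hM ha)
    have hn : ‖(z : H) - z'‖ ≤ 2 * ‖ψ‖ := by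
      refine (norm_sub_le _ _).trans ?_
      rw [← hz, ← hz', hzn, hzn']
      linarith
    have hTz : 0 ≤ ‖T z'‖ := norm_nonneg _
    have hin : (inner ℂ ((z : H) - z') (T z')).re * (w s - w' s) ≤
        (2 * ‖ψ‖) * (a * M) * |w s - w' s| := by
      refine (le_abs_self _).trans ?_
      rw [abs_mul]
      refine mul_le_mul_of_nonneg_right ?_ (abs_nonneg _)
      refine (Complex.abs_re_le_norm _).trans ((norm_inner_le_norm _ _).trans ?_)
      exact mul_le_mul hn hTM hTz (by positivity)
    simp only [Pi.sub_apply]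
    rw [hz, hz', e, inner_add_right, inner_smul_right, Complex.add_re, hself,
      Complex.re_ofReal_mul]
    simp only [C]
    linarith
  choose g hg using hd
  set F : Set ℝ := {s | s ∈ Ico 0 t ∧ w s ≠ v s} ∪ {s | s ∈ Ico 0 t ∧ w' s ≠ v' s}
  have hF : F.Finite := hx.finite.union hx'.finite
  classical
  -- On the finite exceptional set `φ` is the derivative itself, so that it dominates everywhere
  -- without changing the integral.
  set φ : ℝ → ℝ := fun s => if s ∈ F then g s else C * |v s - v' s|
  have hφ : φ =ᵐ[MeasureTheory.volume] fun s => C * |v s - v' s| := by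
    have : ∀ᵐ s : ℝ, s ∉ F := MeasureTheory.measure_eq_zero_iff_ae_notMem.1 (hF.measure_zero _)
    filter_upwards [this] with s hs
    exact if_neg hs
  have key := intervalIntegral.sub_le_integral_of_hasDeriv_right_of_le_Ico (φ := φ) ht
    ((hx.continuousOn.sub hx'.continuousOn).norm.pow 2) (fun s hs => (hg s hs).1)
    ((hint.const_mul C).congr (MeasureTheory.ae_restrict_of_ae hφ.symm)) fun s hs => by
      by_cases hsF : s ∈ F
      · simp only [φ, if_pos hsF]; exact le_rfl
      · simp only [φ, if_neg hsF]
        have h1 := (hg s hs).2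
        simp only [F, mem_union, mem_ofPred_eq, not_or, not_and, not_not] at hsF
        rwa [hsF.1 hs, hsF.2 hs] at h1
  rw [intervalIntegral.integral_congr_ae (hφ.mono fun s hs _ => hs),
    intervalIntegral.integral_const_mul] at key
  simpa [hx.zero, hx'.zero] using key

end Trajectories


/-! ### Existence and uniqueness of propagators -/

section Propagators

variable {H : Type*} [NormedAddCommGroup H] [InnerProductSpace ℂ H] [CompleteSpace H]

theorem abs_mul_le_of_mem_Ioo {δ a c : ℝ} (ha : 0 < a)
    (hc : c ∈ Ioo (-(1 - δ) / a) ((1 - δ) / a)) : |c| * a ≤ 1 - δ := by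
  rw [← le_div_iff₀ ha, abs_le, ← neg_div]
  exact ⟨hc.1.le, hc.2.le⟩

theorem Hypothesis1.isSkewPerturbation {A B : H →ₗ.[ℂ] H} {a : ℝ} (h : Hypothesis1 A B a 0) :
    IsSkewPerturbation A (B.toFun ∘ₗ Submodule.inclusion h.domain_le) a where
  maximalSkew := h.skewAdjoint.isMaximalSkew
  skew x y := h.skewSymmetric (Submodule.inclusion h.domain_le x) (Submodule.inclusion h.domain_le y)
  bound x := by simpa using h.relBound x

namespace Hypothesis1

variable {A B : H →ₗ.[ℂ] H} {δ a : ℝ}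

theorem exists_isStepPropagator (h : Hypothesis1 A B a 0) (hδ : 0 < δ) (ha : 0 < a) {v : ℝ → ℝ}
    (hv : v ∈ boundedControls δ a) (hpc : IsPiecewiseConstant v) {t : ℝ} (ht : 0 ≤ t) :
    ∃ W, IsStepPropagator A B v t W := by
  obtain ⟨N, τ, c, hstep⟩ := hpc t ht
  have hG : ∀ k, ∃ G : ℝ → H →L[ℂ] H, k < N → IsUnitaryGroupOf (A + (c k : ℂ) • B) G := fun k => by
    by_cases hk : k < N
    · have hc := abs_mul_le_of_mem_Ioo ha (hstep.value_mem hv.2 hk)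
      obtain ⟨G, hG⟩ := (h.isSkewPerturbation.isMaximalSkew_perturb ha.le
        (hc.trans_lt (by linarith))).exists_isUnitaryGroupOf
      exact ⟨G, fun _ => add_smul_eq_perturb h.domain_le (c k) ▸ hG⟩
    · exact ⟨0, fun hk' => absurd hk' hk⟩
  choose G hG using hG
  exact ⟨_, N, τ, c, G, hstep, hG, rfl⟩

omit [CompleteSpace H] in
theorem norm_isStepPropagator {v : ℝ → ℝ} {t : ℝ} {W : H →L[ℂ] H}
    (hW : IsStepPropagator A B v t W) (x : H) : ‖W x‖ = ‖x‖ := by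
  obtain ⟨N, τ, c, G, -, hG, rfl⟩ := hW
  exact norm_concatenation (fun j hj => (hG j hj).norm_map) x

theorem exists_isTrajectory (h : Hypothesis1 A B a 0) (hδ : 0 < δ) (ha : 0 < a) {v : ℝ → ℝ}
    (hv : v ∈ boundedControls δ a) {t V : ℝ} (hV : 0 ≤ V)
    (hvar : eVariationOn v (Icc 0 t) ≤ ENNReal.ofReal V) {W : H →L[ℂ] H}
    (hW : IsStepPropagator A B v t W) (ψ : A.domain) :
    ∃ (x : ℝ → H) (w : ℝ → ℝ),
      IsTrajectory A (B.toFun ∘ₗ Submodule.inclusion h.domain_le) v t ψ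
        (Real.exp (a / δ * V) * (2 * ‖A ψ‖) / δ) x w ∧ x t = W ψ := by
  obtain ⟨N, τ, c, G, hstep, hG, rfl⟩ := hW
  exact h.isSkewPerturbation.exists_isTrajectory ha.le hδ hstep
    (fun k hk => abs_mul_le_of_mem_Ioo ha (hstep.value_mem hv.2 hk)) hV hvar
    (fun k hk => add_smul_eq_perturb h.domain_le (c k) ▸ hG k hk) ψ

/-- Step propagators whose controls have the same pointwise limit, and bounded variations, have the
same strong limit on the domain. -/
theorem tendsto_sub (h : Hypothesis1 A B a 0) (hδ : 0 < δ) (ha : 0 < a) {ι : Type*} {l : Filter ι}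
    [l.IsCountablyGenerated] {u : ℝ → ℝ} {v v' : ι → ℝ → ℝ}
    (hv : ∀ i, v i ∈ boundedControls δ a) (hv' : ∀ i, v' i ∈ boundedControls δ a)
    (hvu : ∀ s, Tendsto (fun i => v i s) l (𝓝 (u s)))
    (hvu' : ∀ s, Tendsto (fun i => v' i s) l (𝓝 (u s)))
    {t V : ℝ} (ht : 0 ≤ t) (hV : 0 ≤ V)
    (hvar : ∀ i, eVariationOn (v i) (Icc 0 t) ≤ ENNReal.ofReal V)
    (hvar' : ∀ i, eVariationOn (v' i) (Icc 0 t) ≤ ENNReal.ofReal V) {W W' : ι → H →L[ℂ] H}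
    (hW : ∀ i, IsStepPropagator A B (v i) t (W i))
    (hW' : ∀ i, IsStepPropagator A B (v' i) t (W' i)) (ψ : A.domain) :
    Tendsto (fun i => ‖W i ψ - W' i ψ‖) l (𝓝 0) := by
  have hmeas : ∀ i, Measurable fun s => |v i s - v' i s| := fun i =>
    ((measurable_of_boundedVariationOn (hv i).1.1).sub
      (measurable_of_boundedVariationOn (hv' i).1.1)).abs
  have hbd : ∀ i s, ‖|v i s - v' i s|‖ ≤ 2 * ((1 - δ) / a) := fun i s => by
    have h1 := (hv i).2 s
    have h2 := (hv' i).2 s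
    rw [neg_div] at h1 h2
    rw [Real.norm_eq_abs, abs_abs, abs_le]
    exact ⟨by linarith [h1.1, h2.2], by linarith [h1.2, h2.1]⟩
  have hint : ∀ i, MeasureTheory.IntegrableOn (fun s => |v i s - v' i s|) (Icc 0 t) := fun i =>
    MeasureTheory.Measure.integrableOn_of_bounded (M := 2 * ((1 - δ) / a)) (by simp)
      (hmeas i).aestronglyMeasurable (Eventually.of_forall fun s => hbd i s)
  have hlim : Tendsto (fun i => ∫ s in (0 : ℝ)..t, |v i s - v' i s|) l (𝓝 0) := by
    have := intervalIntegral.tendsto_integral_filter_of_dominated_convergence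
      (μ := MeasureTheory.volume) (a := 0) (b := t) (l := l)
      (F := fun i s => |v i s - v' i s|) (f := fun _ => (0 : ℝ)) (fun _ => 2 * ((1 - δ) / a))
      (Eventually.of_forall fun i => (hmeas i).aestronglyMeasurable)
      (Eventually.of_forall fun i => Eventually.of_forall fun s _ => hbd i s)
      intervalIntegrable_const
      (Eventually.of_forall fun s _ => by simpa using ((hvu s).sub (hvu' s)).abs)
    simpa using this
  have hsq : Tendsto (fun i => ‖W i ψ - W' i ψ‖ ^ 2) l (𝓝 0) := by
    have hC := hlim.const_mul (4 * ‖(ψ : H)‖ * (a * (Real.exp (a / δ * V) * (2 * ‖A ψ‖) / δ)))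
    rw [mul_zero] at hC
    refine squeeze_zero (fun i => sq_nonneg _) (fun i => ?_) hC
    obtain ⟨x, w, hx, hxW⟩ := h.exists_isTrajectory hδ ha (hv i) hV (hvar i) (hW i) ψ
    obtain ⟨x', w', hx', hxW'⟩ := h.exists_isTrajectory hδ ha (hv' i) hV (hvar' i) (hW' i) ψ
    rw [← hxW, ← hxW']
    exact h.isSkewPerturbation.norm_sub_sq_le ha.le ht hx hx' (hint i)
  simpa using hsq.sqrt

/-- The variation of `u` over the whole line serves as one bound for all horizons `T`, so sequences
with different horizons can be compared. -/
theorem _root_.BVControl.IsApproximation.variation_le_ofReal {T t : ℝ} {u : ℝ → ℝ}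
    {v : ℕ → ℝ → ℝ} (hv : IsApproximation δ a T u v) (hu : u ∈ boundedControls δ a) (htT : t ≤ T)
    (n : ℕ) :
    eVariationOn (v n) (Icc 0 t) ≤ ENNReal.ofReal (eVariationOn u univ).toReal := by
  rw [ENNReal.ofReal_toReal hu.1.1]
  exact ((eVariationOn.mono _ (Icc_subset_Icc_right htT)).trans (hv.variation_le n)).trans
    (eVariationOn.mono _ (subset_univ _))

/-- The propagator of `x' = (A + u B) x` exists and is unique for every control `u` of bounded
variation in `𝒰_{δ,a}`. -/
theorem existsUnique_isPropagator (h : Hypothesis1 A B a 0) (hδ : 0 < δ) (ha : 0 < a) {u : ℝ → ℝ}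
    (hu : u ∈ boundedControls δ a) {t : ℝ} (ht : 0 ≤ t) :
    ∃! U : H →L[ℂ] H, IsPropagator A B δ a u t U := by
  obtain ⟨v, hv⟩ := exists_isApproximation hu t
  have hex : ∀ {T : ℝ} {v : ℕ → ℝ → ℝ}, IsApproximation δ a T u v →
      ∃ W : ℕ → H →L[ℂ] H, ∀ n, IsStepPropagator A B (v n) t (W n) := fun hv => by
    choose W hW using fun n =>
      h.exists_isStepPropagator hδ ha (hv.mem n) (hv.piecewiseConstant n) ht
    exact ⟨W, hW⟩
  obtain ⟨W, hW⟩ := hex hv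
  have hdense : Dense (A.domain : Set H) := h.skewAdjoint.1
  have hV : 0 ≤ (eVariationOn u univ).toReal := ENNReal.toReal_nonneg
  obtain ⟨U, hU⟩ := exists_tendsto_of_cauchySeq_dense (W := W)
    (fun n x => (norm_isStepPropagator (hW n) x).le) hdense fun x hx => by
      rw [cauchySeq_iff_tendsto_dist_atTop_0]
      simp only [dist_eq_norm]
      have hfst : Tendsto (Prod.fst : ℕ × ℕ → ℕ) atTop atTop := by
        rw [← prod_atTop_atTop_eq]; exact tendsto_fst
      have hsnd : Tendsto (Prod.snd : ℕ × ℕ → ℕ) atTop atTop := by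
        rw [← prod_atTop_atTop_eq]; exact tendsto_snd
      -- The comparison of two sequences, applied to one sequence along pairs of indices, is the
      -- Cauchy property.
      exact h.tendsto_sub hδ ha (l := atTop) (u := u) (v := fun n : ℕ × ℕ => v n.1)
        (v' := fun n : ℕ × ℕ => v n.2) (fun n => hv.mem _) (fun n => hv.mem _)
        (fun s => (hv.tendsto s).comp hfst) (fun s => (hv.tendsto s).comp hsnd) ht hV
        (fun n => hv.variation_le_ofReal hu le_rfl _) (fun n => hv.variation_le_ofReal hu le_rfl _)
        (fun n => hW n.1) (fun n => hW n.2) ⟨x, hx⟩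
  refine ⟨U, fun T htT => ⟨exists_isApproximation hu T, fun v' hv' => ⟨hex hv', ?_⟩⟩, ?_⟩
  · intro W' hW' ψ hψ
    have h1 := h.tendsto_sub hδ ha hv'.mem hv.mem hv'.tendsto hv.tendsto ht hV
      (hv'.variation_le_ofReal hu htT) (hv.variation_le_ofReal hu le_rfl) hW' hW ⟨ψ, hψ⟩
    have h2 := (tendsto_zero_iff_norm_tendsto_zero.2 h1).add (hU ψ)
    simpa using h2
  · intro U' hU'
    have hlim := (((hU' t le_rfl).2 v hv).2 W hW)
    refine ContinuousLinearMap.ext fun x => ?_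
    exact congrFun (Continuous.ext_on hdense U'.continuous U.continuous fun ψ hψ =>
      tendsto_nhds_unique (hlim ψ hψ) (hU ψ)) x

end Hypothesis1

/-! ### Transport of propagators by a phase -/

omit [CompleteSpace H] in
theorem mem_graph_shift_add (A B : H →ₗ.[ℂ] H) (lam : ℝ) (c : ℂ) (x y : H) :
    (x, y) ∈ (shift A lam + c • B).graph ↔
      (x, y - (Complex.I * (lam : ℂ)) • x) ∈ (A + c • B).graph := by
  have key : ∀ z : (A.domain ⊓ B.domain : Submodule ℂ H), (shift A lam + c • B) z =
      (Complex.I * (lam : ℂ)) • (z : H) + (A + c • B) z := fun z => by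
    exact add_assoc ((Complex.I * (lam : ℂ)) • (z : H)) (A ⟨z, z.2.1⟩) ((c • B) ⟨z, z.2.2⟩)
  rw [LinearPMap.mem_graph_iff, LinearPMap.mem_graph_iff]
  constructor
  · rintro ⟨z, rfl, rfl⟩
    exact ⟨z, rfl, by simp only [key z, add_sub_cancel_left]⟩
  · rintro ⟨z, rfl, hz⟩
    exact ⟨z, rfl, by simp only at hz; rw [key z, hz, add_sub_cancel]⟩

-- The exponents telescope, so the total phase depends on the endpoints only.
omit [CompleteSpace H] in
theorem concatenation_exp_smul (G : ℕ → ℝ → H →L[ℂ] H) (τ : ℕ → ℝ) (lam : ℝ) (N : ℕ) :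
    concatenation (fun k s => Complex.exp (Complex.I * (lam : ℂ) * (s : ℂ)) • G k s) τ N =
      Complex.exp (Complex.I * (lam : ℂ) * ((τ N - τ 0 : ℝ) : ℂ)) • concatenation G τ N := by
  induction N with
  | zero => simp [concatenation]
  | succ k ih =>
    rw [concatenation, concatenation, ih, smul_mul_smul_comm, ← Complex.exp_add]
    congr 2
    push_cast
    ring

omit [CompleteSpace H] in
/-- Adding `iλ` to the generator multiplies step propagators by a phase. -/
theorem IsStepPropagator.exp_smul {A A' B : H →ₗ.[ℂ] H} {lam : ℝ}
    (hA' : ∀ (c : ℂ) (x y : H), (x, y) ∈ (A' + c • B).graph ↔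
      (x, y - (Complex.I * (lam : ℂ)) • x) ∈ (A + c • B).graph)
    {v : ℝ → ℝ} {t : ℝ} {W : H →L[ℂ] H} (hW : IsStepPropagator A B v t W) :
    IsStepPropagator A' B v t (Complex.exp (Complex.I * (lam : ℂ) * (t : ℂ)) • W) := by
  obtain ⟨N, τ, c, G, hstep, hG, rfl⟩ := hW
  refine ⟨N, τ, c, fun k s => Complex.exp (Complex.I * (lam : ℂ) * (s : ℂ)) • G k s, hstep,
    fun k hk => (hG k hk).exp_smul (hA' _), ?_⟩
  rw [concatenation_exp_smul, hstep.1, hstep.2.1, sub_zero]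

omit [CompleteSpace H] in
/-- Adding `iλ` to the generator multiplies propagators by a phase. -/
theorem IsPropagator.exp_smul {A A' B : H →ₗ.[ℂ] H} {lam : ℝ} (hdom : A'.domain = A.domain)
    (hA' : ∀ (c : ℂ) (x y : H), (x, y) ∈ (A' + c • B).graph ↔
      (x, y - (Complex.I * (lam : ℂ)) • x) ∈ (A + c • B).graph)
    {δ a : ℝ} {u : ℝ → ℝ} {t : ℝ} {U : H →L[ℂ] H} (hU : IsPropagator A B δ a u t U) :
    IsPropagator A' B δ a u t (Complex.exp (Complex.I * (lam : ℂ) * (t : ℂ)) • U) := by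
  -- The limit is required for every choice of step propagators of `A'`; these are pulled back to
  -- `A` by the inverse phase.
  have hA : ∀ (c : ℂ) (x y : H), (x, y) ∈ (A + c • B).graph ↔
      (x, y - (Complex.I * ((-lam : ℝ) : ℂ)) • x) ∈ (A' + c • B).graph := fun c x y => by
    rw [hA', sub_sub, ← add_smul]
    simp
  intro T hT
  obtain ⟨hex, happ⟩ := hU T hT
  refine ⟨hex, fun v hv => ?_⟩
  obtain ⟨⟨W, hW⟩, hlim⟩ := happ v hv
  refine ⟨⟨_, fun n => (hW n).exp_smul hA'⟩, fun W' hW' ψ hψ => ?_⟩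
  have h1 := (hlim _ (fun n => (hW' n).exp_smul hA) ψ (hdom ▸ hψ)).const_smul
    (Complex.exp (Complex.I * (lam : ℂ) * (t : ℂ)))
  simp only [smul_apply, smul_smul, ← Complex.exp_add] at h1
  simpa using h1

theorem IsPropagator.shift_iff {A B : H →ₗ.[ℂ] H} {lam : ℝ} {δ a : ℝ} {u : ℝ → ℝ} {t : ℝ}
    {V : H →L[ℂ] H} :
    IsPropagator (shift A lam) B δ a u t V ↔
      IsPropagator A B δ a u t (Complex.exp (-(Complex.I * (lam : ℂ) * (t : ℂ))) • V) := by
  refine ⟨fun hV => ?_, fun hU => ?_⟩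
  · have := hV.exp_smul (A := shift A lam) (A' := A) (B := B) (lam := -lam) rfl fun c x y => by
      rw [mem_graph_shift_add, sub_sub, ← add_smul]
      simp
    simpa using this
  · have := hU.exp_smul (A := A) (A' := shift A lam) (lam := lam) rfl (mem_graph_shift_add A B lam)
    rwa [smul_smul, ← Complex.exp_add, add_neg_cancel, Complex.exp_zero, one_smul] at this

end Propagators

end BVControl

theorem mainTheorem6 {H : Type*} [NormedAddCommGroup H] [InnerProductSpace ℂ H] [CompleteSpace H]
    [TopologicalSpace.SeparableSpace H]
    (δ a : ℝ) (hδ : δ ∈ Set.Ioo (0 : ℝ) 1) (ha : 0 < a)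
    (u : ℝ → ℝ) (hu : u ∈ BVControl.boundedControls δ a)
    (A B : H →ₗ.[ℂ] H) (hAB : BVControl.Hypothesis1 A B a 0)
    (lam : ℝ) (t : ℝ) (ht : 0 ≤ t) :
    (∃! U : H →L[ℂ] H, BVControl.IsPropagator A B δ a u t U) ∧
    (∃! V : H →L[ℂ] H, BVControl.IsPropagator (BVControl.shift A lam) B δ a u t V) ∧
    ∀ U V : H →L[ℂ] H,
      BVControl.IsPropagator A B δ a u t U →
      BVControl.IsPropagator (BVControl.shift A lam) B δ a u t V →
      V = Complex.exp (Complex.I * (lam : ℂ) * (t : ℂ)) • U := by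
  have hU := hAB.existsUnique_isPropagator hδ.1 ha hu ht
  have hphase : ∀ U V : H →L[ℂ] H, BVControl.IsPropagator A B δ a u t U →
      BVControl.IsPropagator (BVControl.shift A lam) B δ a u t V →
      V = Complex.exp (Complex.I * (lam : ℂ) * (t : ℂ)) • U := fun U V h h' => by
    rw [hU.unique h (BVControl.IsPropagator.shift_iff.1 h'), smul_smul, ← Complex.exp_add,
      add_neg_cancel, Complex.exp_zero, one_smul]
  refine ⟨hU, ?_, hphase⟩
  obtain ⟨U, h, -⟩ := hU
  refine ⟨Complex.exp (Complex.I * (lam : ℂ) * (t : ℂ)) • U, ?_, fun V hV => hphase U V h hV⟩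
  refine BVControl.IsPropagator.shift_iff.2 ?_
  rwa [smul_smul, ← Complex.exp_add, neg_add_cancel, Complex.exp_zero, one_smul]
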